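/- Let $1<\alpha<2$, $\lambda\ge 0$, and let $r_3\in\mathbb R$ be arbitrary. Put $r_1=\frac{\alpha}{2}+r_3$ and $r_2=\frac{2-\alpha}{2}-2r_3$. Then $r_1+r_2+r_3=1$. For $\beta>0$ let $n$ be the smallest integer exceeding $\beta$, and for $G:\mathbb R\to\mathbb C$ let $${}_{-\infty}\nabla_x^{\beta,\lambda}G(x)=\frac{e^{-\lambda x}}{\Gamma(n-\beta)}\frac{d^n}{dx^n}\int_{-\infty}^x\frac{e^{\lambda\xi}G(\xi)}{(x-\xi)^{\beta-n+1}}\,d\xi-\lambda^{\beta}G(x).$$ We say that this derivative exists if the integral converges absolutely for every $x$ and is $n$ times differentiable in $x$ on $\mathbb R$. Let $\widehat f(\omega)=\int_{\mathbb R}e^{i\omega x}f(x)\,dx$. Let $g_0^\alpha=1$, $g_j^\alpha=\bigl(1-\frac{\alpha+1}{j}\bigr)g_{j-1}^\alpha$ for $j\ge1$, and for $h>0$, $p\in\mathbb R$ let $$A_p^{\alpha,\lambda}G(x)=\frac1{h^\alpha}\sum_{j=0}^\infty e^{-(j-p)\lambda h}g_j^\alpha\,G(x-(j-p)h)-e^{ph\lambda}\frac{(1-e^{-h\lambda})^\alpha}{h^\alpha}G(x).$$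 Let $G:\mathbb R\to\mathbb C$ be such that ${}_{-\infty}\nabla_x^{\alpha+2,\lambda}G$ exists and such that $G$, ${}_{-\infty}\nabla_x^{\alpha+2,\lambda}G$, $\widehat G$ and the Fourier transform of ${}_{-\infty}\nabla_x^{\alpha+2,\lambda}G$ all belong to $L^1(\mathbb R)$. Then ${}_{-\infty}\nabla_x^{\alpha,\lambda}G$ exists; for all $h>0$ and $p\in\mathbb R$ the series defining $A_p^{\alpha,\lambda}G(x)$ converges absolutely for almost every $x$; and for every $h_0>0$ there is a constant $C$, independent of $h$ and $x$, such that for every $h\in(0,h_0]$ $$\Bigl|{}_{-\infty}\nabla_x^{\alpha,\lambda}G(x)-\bigl(r_1A_1^{\alpha,\lambda}+r_2A_0^{\alpha,\lambda}+r_3A_{-1}^{\alpha,\lambda}\bigr)G(x)\Bigr|\le C\,h^2$$ for almost every $x\in\mathbb R$. If $G$ is continuous, the convergence and the estimate hold for every $x\in\mathbb R$. -/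

import Mathlib

open MeasureTheory Set

namespace TemperedGrunwald

noncomputable section

/-- The Fourier transform in the convention `Ĝ(ω) = ∫ e^{iωx} G(x) dx`. -/
def fourierHat (G : ℝ → ℂ) (ω : ℝ) : ℂ :=
  ∫ x : ℝ, Complex.exp (Complex.I * (ω : ℂ) * (x : ℂ)) * G x

/-- The smallest natural number exceeding `α` (for `0 ≤ α`). -/
def rlOrder (α : ℝ) : ℕ := ⌊α⌋₊ + 1

/-- The integrand `f(ξ) (x - ξ)^(β-1)` of the left Riemann–Liouville integral of order `β`. -/
def rlIntegrand (β : ℝ) (f : ℝ → ℂ) (x ξ : ℝ) : ℂ :=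
  (((x - ξ) ^ (β - 1) : ℝ) : ℂ) * f ξ

/-- The left Riemann–Liouville fractional integral of order `β` on `(-∞, x)`:
`1/Γ(β) ∫_{-∞}^x (x - ξ)^(β-1) f(ξ) dξ`. -/
def leftRLIntegral (β : ℝ) (f : ℝ → ℂ) (x : ℝ) : ℂ :=
  ((1 / Real.Gamma β : ℝ) : ℂ) * ∫ ξ in Iio x, rlIntegrand β f x ξ

/-- The left Riemann–Liouville fractional derivative of order `α` with lower limit `-∞`:
`1/Γ(n-α) dⁿ/dxⁿ ∫_{-∞}^x f(ξ) (x - ξ)^(n-α-1) dξ`, with `n` the smallest integer exceeding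
`α`. -/
def leftRLDeriv (α : ℝ) (f : ℝ → ℂ) (x : ℝ) : ℂ :=
  iteratedDeriv (rlOrder α) (leftRLIntegral ((rlOrder α : ℝ) - α) f) x

/-- The left Riemann–Liouville derivative of order `α` exists on `ℝ`: the fractional integral
converges absolutely at every point and is `n` times differentiable. -/
def HasLeftRLDeriv (α : ℝ) (f : ℝ → ℂ) : Prop :=
  (∀ x : ℝ, IntegrableOn (rlIntegrand ((rlOrder α : ℝ) - α) f x) (Iio x)) ∧
    ∀ k < rlOrder α,
      Differentiable ℝ (iteratedDeriv k (leftRLIntegral ((rlOrder α : ℝ) - α) f))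

/-- The function `x ↦ e^{λx} G(x)`. -/
def expMul (lam : ℝ) (G : ℝ → ℂ) (x : ℝ) : ℂ :=
  ((Real.exp (lam * x) : ℝ) : ℂ) * G x

/-- The left tempered Riemann–Liouville derivative
`e^{-λx} D^α[e^{λx} G](x) - λ^α G(x)` with lower limit `-∞`. -/
def temperedRLDeriv (α lam : ℝ) (G : ℝ → ℂ) (x : ℝ) : ℂ :=
  ((Real.exp (-(lam * x)) : ℝ) : ℂ) * leftRLDeriv α (expMul lam G) x
    - ((lam ^ α : ℝ) : ℂ) * G x

/-- The Grünwald weights `g₀ = 1`, `g_j = (1 - (α+1)/j) g_{j-1}` for `j ≥ 1`. -/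
def grunwaldWeight (α : ℝ) : ℕ → ℝ
  | 0 => 1
  | j + 1 => (1 - (α + 1) / ((j + 1 : ℕ) : ℝ)) * grunwaldWeight α j

/-- The `j`-th term `e^{-(j-p)λh} g_j G(x - (j-p)h)` of the shifted tempered Grünwald series. -/
def grunwaldTerm (α lam h p : ℝ) (G : ℝ → ℂ) (x : ℝ) (j : ℕ) : ℂ :=
  ((Real.exp (-((j : ℝ) - p) * lam * h) * grunwaldWeight α j : ℝ) : ℂ) *
    G (x - ((j : ℝ) - p) * h)

/-- The shifted tempered Grünwald operator `A_p^{α,λ}` with step `h`. -/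
def shiftedGrunwald (α lam h p : ℝ) (G : ℝ → ℂ) (x : ℝ) : ℂ :=
  ((1 / h ^ α : ℝ) : ℂ) * (∑' j : ℕ, grunwaldTerm α lam h p G x j)
    - ((Real.exp (p * h * lam) * ((1 - Real.exp (-(h * lam))) ^ α / h ^ α) : ℝ) : ℂ) * G x

/-- The weighted operator `r₁ A₁ + r₂ A₀ + r₃ A₋₁`. -/
def weightedGrunwald (α lam h r₁ r₂ r₃ : ℝ) (G : ℝ → ℂ) (x : ℝ) : ℂ :=
  (r₁ : ℂ) * shiftedGrunwald α lam h 1 G x + (r₂ : ℂ) * shiftedGrunwald α lam h 0 G x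
    + (r₃ : ℂ) * shiftedGrunwald α lam h (-1) G x

end

end TemperedGrunwald

namespace TemperedGrunwald

open Filter Topology Asymptotics

open scoped FourierTransform SchwartzMap

/-! With g = Ĝ/(2π), inversion gives e^{λx}G(x) = ∫ e^{zx} g(ω) dω almost everywhere, where z = λ -
iω. In this representation every operator is a multiplier. The Riemann–Liouville integral of order 2
- α contributes z^{α-2} (`leftRLIntegral_eq_expInt`). The shifted Grünwald sum contributes e^{phz}(1
- e^{-hz})^α, by the binomial series up to the unit circle (`hasSum_grunwaldTerm`).

The error symbol z^α - h^{-α}(r₁e^{hz} + r₂ + r₃e^{-hz})(1 - e^{-hz})^α is at most C h²|z|^{α+2} on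
a vertical strip (`exists_symbol_bound`): the choice of r₁, r₂, r₃ cancels the linear term of the
expansion at 0, and away from 0 a crude bound suffices. The correction terms in λ are the same
symbol at z = λ.

What remains is the integrability of |z|^{α+2}|g|. The derivative of order α + 2 is known only to
exist pointwise and to have an integrable transform, so its density must be identified. Taking four
unit backward differences replaces differentiation by bounded multipliers, and uniqueness of
densities then gives the density z⁴·z^{α-2}g (`ae_eq_freq_pow_four_mul`, `exists_density`). -/

/-! ### Fourier inversion and uniqueness for integrable functions -/

/-- Fourier inversion almost everywhere, with no continuity assumption. -/
theorem ae_eq_fourierInv_fourier {f : ℝ → ℂ} (hf : Integrable f) (hf' : Integrable (𝓕 f)) :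
    f =ᵐ[volume] 𝓕⁻ (𝓕 f) := by
  have hcont : Continuous (𝓕⁻ (𝓕 f)) := by
    rw [Real.fourierInv_eq_fourier_comp_neg]
    exact VectorFourier.fourierIntegral_continuous Real.continuous_fourierChar
      continuous_inner hf'.comp_neg
  -- Test against smooth compactly supported θ. With χ the inverse transform of θ, the Fourier
  -- multiplication formula turns both pairings into ∫ χ · 𝓕 f.
  refine ae_eq_of_integral_contDiff_smul_eq hf.locallyIntegrable hcont.locallyIntegrable ?_
  intro θ hθ hθc
  let Θ : 𝓢(ℝ, ℂ) := HasCompactSupport.toSchwartzMap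
    (f := fun x => (θ x : ℂ)) (hθc.comp_left (g := fun t : ℝ => (t : ℂ)) (by simp))
      (Complex.ofRealCLM.contDiff.comp hθ)
  have hΘ : ∀ x, Θ x = (θ x : ℂ) := fun x => rfl
  let χ : 𝓢(ℝ, ℂ) := 𝓕⁻ Θ
  have hχ : 𝓕 (χ : ℝ → ℂ) = Θ := by
    rw [← SchwartzMap.fourier_coe]
    simp [χ]
  have h1 : ∫ x, θ x • f x = ∫ x, χ x • 𝓕 f x := by
    have := VectorFourier.integral_fourierIntegral_smul_eq_flip (L := innerₗ ℝ)
      Real.continuous_fourierChar continuous_inner χ.integrable hf (μ := volume) (ν := volume)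
    rw [show VectorFourier.fourierIntegral Real.fourierChar volume (innerₗ ℝ) (χ : ℝ → ℂ)
      = Θ from hχ] at this
    simp only [flip_innerₗ] at this
    refine Eq.trans ?_ this
    refine integral_congr_ae (.of_forall fun x => ?_)
    simp [hΘ]
  have h2 : ∫ x, θ x • 𝓕⁻ (𝓕 f) x = ∫ x, χ x • 𝓕 f x := by
    -- The inverse transform is the forward transform for the negated pairing.
    have := VectorFourier.integral_fourierIntegral_smul_eq_flip (L := -innerₗ ℝ)
      Real.continuous_fourierChar (show Continuous fun p : ℝ × ℝ => (-innerₗ ℝ) p.1 p.2 from continuous_inner.neg)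
      Θ.integrable hf' (μ := volume) (ν := volume)
    have e1 : VectorFourier.fourierIntegral Real.fourierChar volume (-innerₗ ℝ) (Θ : ℝ → ℂ)
      = χ := by
      have : (χ : ℝ → ℂ) = 𝓕⁻ (Θ : ℝ → ℂ) := SchwartzMap.fourierInv_coe Θ
      rw [this]; rfl
    rw [e1] at this
    have e2 : (-innerₗ ℝ).flip = -innerₗ ℝ := by
      ext; simp
    rw [e2] at this
    rw [this]
    refine integral_congr_ae (.of_forall fun x => ?_)
    simp only [hΘ]
    rw [Complex.real_smul]; rfl
  rw [h1, h2]

theorem ae_eq_zero_of_fourier_eq_zero {f : ℝ → ℂ} (hf : Integrable f) (h : ∀ x, 𝓕 f x = 0) :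
    f =ᵐ[volume] 0 := by
  have h0 : 𝓕 f = 0 := funext h
  have := ae_eq_fourierInv_fourier hf (by rw [h0]; exact integrable_zero _ _ _)
  refine this.trans (.of_forall fun x => ?_)
  rw [h0, Real.fourierInv_eq']
  simp

theorem ae_eq_zero_of_integral_exp_eq_zero {g : ℝ → ℂ} (hg : Integrable g)
    (h : ∀ x : ℝ, ∫ w : ℝ, Complex.exp (-(Complex.I * w * x)) * g w = 0) : g =ᵐ[volume] 0 := by
  refine ae_eq_zero_of_fourier_eq_zero hg fun x => ?_
  rw [Real.fourier_real_eq_integral_exp_smul, ← h (2 * Real.pi * x)]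
  refine integral_congr_ae (.of_forall fun w => ?_)
  simp only [smul_eq_mul]
  congr 2
  push_cast
  ring

theorem fourier_eq_fourierHat (G : ℝ → ℂ) (ξ : ℝ) : 𝓕 G ξ = fourierHat G (-(2 * Real.pi) * ξ) := by
  rw [Real.fourier_real_eq_integral_exp_smul, fourierHat]
  refine integral_congr_ae (.of_forall fun w => ?_)
  simp only [smul_eq_mul]
  congr 2
  push_cast
  ring

/-- Fourier inversion in the convention of `fourierHat`. -/
theorem ae_eq_integral_fourierHat {G : ℝ → ℂ} (hG : Integrable G)
    (hG' : Integrable (fourierHat G)) :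
    ∀ᵐ x : ℝ, G x = (1 / (2 * Real.pi) : ℝ) *
      ∫ w : ℝ, Complex.exp (-(Complex.I * w * x)) * fourierHat G w := by
  have hπ : -(2 * Real.pi) ≠ 0 := by simp [Real.pi_ne_zero]
  have hF : Integrable (𝓕 G) := by
    rw [show 𝓕 G = fun ξ => fourierHat G (-(2 * Real.pi) * ξ) from
      funext (fourier_eq_fourierHat G)]
    exact hG'.comp_mul_left' hπ
  filter_upwards [ae_eq_fourierInv_fourier hG hF] with x hx
  rw [hx, Real.fourierInv_eq']
  have := Measure.integral_comp_mul_left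
    (fun w : ℝ => Complex.exp (-(Complex.I * w * x)) * fourierHat G w) (-(2 * Real.pi))
  rw [show |(-(2 * Real.pi))⁻¹| = 1 / (2 * Real.pi) by
    rw [abs_inv, abs_neg, abs_of_pos (by positivity), one_div], Complex.real_smul] at this
  rw [← this]
  refine integral_congr_ae (.of_forall fun w => ?_)
  simp only [smul_eq_mul, fourier_eq_fourierHat, RCLike.inner_apply, conj_trivial]
  congr 2
  push_cast
  ring

/-! ### Second-order consistency of the symbol -/

theorem one_add_cpow_sub_isBigO (a : ℂ) :
    (fun s : ℂ => (1 + s) ^ a - (1 + a * s)) =O[𝓝 0] fun s => s ^ 2 := by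
  have h := (Complex.one_add_cpow_hasFPowerSeriesAt_zero (a := a)).isBigO_sub_partialSum_pow 2
  have h2 := h.norm_right
  refine (IsBigO.trans (h.congr (fun s => ?_) fun s => rfl) ?_)
  · simp [FormalMultilinearSeries.partialSum, Finset.sum_range_succ, binomialSeries,
      FormalMultilinearSeries.coeff_ofScalars, mul_comm]
  · exact isBigO_of_le _ fun s => by simp

theorem exp_mul_sub_isBigO (p : ℂ) :
    (fun z : ℂ => Complex.exp (p * z) - (1 + p * z)) =O[𝓝 0] fun z => z ^ 2 := by
  have h : (fun z : ℂ => Complex.exp z - (1 + z)) =O[𝓝 0] fun z => z ^ 2 := by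
    have := (NormedSpace.exp_hasFPowerSeriesAt_zero (𝕂 := ℂ) (𝔸 := ℂ)).isBigO_sub_partialSum_pow 2
    refine (IsBigO.trans (this.congr (fun s => ?_) fun s => rfl) ?_)
    · simp [FormalMultilinearSeries.partialSum, Finset.sum_range_succ,
        NormedSpace.expSeries_eq_ofScalars, FormalMultilinearSeries.coeff_ofScalars,
        Complex.exp_eq_exp_ℂ]
    · exact isBigO_of_le _ fun s => by simp
  have ht : Tendsto (fun z : ℂ => p * z) (𝓝 0) (𝓝 0) := by
    simpa using (continuous_const_mul p).tendsto (0 : ℂ)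
  refine (h.comp_tendsto ht).trans ?_
  refine IsBigO.of_bound (‖p‖ ^ 2) (.of_forall fun z => ?_)
  simp [mul_pow]

/-- The normalised backward difference symbol `(1 - e^{-z}) / z`. -/
noncomputable def diffQuot (z : ℂ) : ℂ := (1 - Complex.exp (-z)) / z

/-- The exponential is expanded to third order because division by z costs one power. The
neighbourhood is punctured since `diffQuot 0 = 0` by convention, while the limit at 0 is 1. -/
theorem diffQuot_sub_isBigO :
    (fun z : ℂ => diffQuot z - 1 + z / 2) =O[𝓝[≠] 0] fun z => z ^ 2 := by
  have h := (NormedSpace.exp_hasFPowerSeriesAt_zero (𝕂 := ℂ) (𝔸 := ℂ)).isBigO_sub_partialSum_pow 3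
  have ht : Tendsto (fun z : ℂ => -z) (𝓝[≠] 0) (𝓝 0) := by
    simpa using (continuous_neg.tendsto (0 : ℂ)).mono_left nhdsWithin_le_nhds
  have h' := h.comp_tendsto ht
  obtain ⟨C, hC⟩ := h'.bound
  refine IsBigO.of_bound C ?_
  filter_upwards [hC, self_mem_nhdsWithin] with z hz hz0
  have hz0 : z ≠ 0 := hz0
  have e : diffQuot z - 1 + z / 2 = -(Complex.exp (-z) - (1 - z + z ^ 2 / 2)) / z := by
    rw [diffQuot]; field_simp; ring
  rw [e, norm_div, norm_neg, norm_pow, div_le_iff₀ (norm_pos_iff.2 hz0)]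
  calc _ ≤ C * ‖z‖ ^ 3 := by
        have e2 : (NormedSpace.expSeries ℂ ℂ).partialSum 3 (-z) = 1 - z + z ^ 2 / 2 := by
          simp [FormalMultilinearSeries.partialSum, Finset.sum_range_succ,
            NormedSpace.expSeries_eq_ofScalars, FormalMultilinearSeries.coeff_ofScalars]
          ring
        simpa only [Function.comp, zero_add, e2, norm_neg, norm_pow, norm_norm,
          Complex.exp_eq_exp_ℂ] using hz
    _ = _ := by ring

theorem diffQuot_cpow_sub_isBigO (a : ℂ) :
    (fun z : ℂ => diffQuot z ^ a - (1 - a * z / 2)) =O[𝓝[≠] 0] fun z => z ^ 2 := by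
  have hid : (fun z : ℂ => z ^ 2) =O[𝓝[≠] 0] fun z : ℂ => z := by
    have : (fun z : ℂ => z ^ 2) =O[𝓝 0] fun z : ℂ => z :=
      (isLittleO_pow_id one_lt_two).isBigO
    exact this.mono nhdsWithin_le_nhds
  have h1 : (fun z : ℂ => diffQuot z - 1) =O[𝓝[≠] 0] fun z => z := by
    have := (diffQuot_sub_isBigO.trans hid).sub
      ((isBigO_refl (fun z : ℂ => z) (𝓝[≠] 0)).const_mul_left (1 / 2))
    refine this.congr_left fun z => ?_
    ring
  have ht : Tendsto (fun z : ℂ => diffQuot z - 1) (𝓝[≠] 0) (𝓝 0) :=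
    h1.trans_tendsto (tendsto_id.mono_left nhdsWithin_le_nhds)
  have h2 := ((one_add_cpow_sub_isBigO a).comp_tendsto ht).trans (h1.pow 2)
  have h3 := diffQuot_sub_isBigO.const_mul_left a
  refine (h2.add h3).congr_left fun z => ?_
  simp only [Function.comp]
  ring_nf

/-- The consistency conditions make the weighted combination of shifted symbols second-order. -/
theorem weighted_diffQuot_isBigO (a r₁ r₂ r₃ : ℂ) (h₁ : r₁ = a / 2 + r₃)
    (h₂ : r₂ = (2 - a) / 2 - 2 * r₃) :
    (fun z : ℂ => (r₁ * Complex.exp z + r₂ + r₃ * Complex.exp (-z)) * diffQuot z ^ a - 1)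
      =O[𝓝[≠] 0] fun z => z ^ 2 := by
  have hq := diffQuot_cpow_sub_isBigO a
  have e1 := ((exp_mul_sub_isBigO 1).mono (nhdsWithin_le_nhds (s := {0}ᶜ))).const_mul_left r₁
  have e3 := ((exp_mul_sub_isBigO (-1)).mono (nhdsWithin_le_nhds (s := {0}ᶜ))).const_mul_left r₃
  have hE := e1.add e3
  have hE1 : (fun z : ℂ => r₁ * Complex.exp z + r₂ + r₃ * Complex.exp (-z)) =O[𝓝[≠] 0]
      fun _ => (1 : ℂ) := by
    have : Continuous fun z : ℂ => r₁ * Complex.exp z + r₂ + r₃ * Complex.exp (-z) := by fun_prop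
    exact (this.tendsto 0).mono_left nhdsWithin_le_nhds |>.isBigO_one ℂ
  have hL1 : (fun z : ℂ => 1 - a * z / 2) =O[𝓝[≠] 0] fun _ => (1 : ℂ) := by
    have : Continuous fun z : ℂ => 1 - a * z / 2 := by fun_prop
    exact (this.tendsto 0).mono_left nhdsWithin_le_nhds |>.isBigO_one ℂ
  have t1 := (hE1.mul hq).congr_right fun z => one_mul _
  have t2 := (hE.mul hL1).congr_right fun z => mul_one _
  -- To first order the product is (1 + (r₁ - r₃)z)(1 - az/2), using r₁ + r₂ + r₃ = 1. Since r₁ - r₃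
  -- = a/2 the linear terms cancel, leaving this multiple of z².
  have t3 := (isBigO_refl (fun z : ℂ => z ^ 2) (𝓝[≠] 0)).const_mul_left (-(r₁ - r₃) * (a / 2))
  refine ((t1.add t2).add t3).congr_left fun z => ?_
  simp only [one_mul, neg_mul]
  subst h₁ h₂
  ring

/-- Principal powers are multiplicative only if the arguments add up inside (-π, π]. Here |arg z| ≤
π/2 in the closed right half plane, and near 0 the quotient is close to 1, so its argument is below
1 in absolute value. -/
theorem exists_one_sub_exp_neg_cpow (a : ℂ) : ∃ ρ > 0, ∀ z : ℂ, 0 ≤ z.re → z ≠ 0 → ‖z‖ < ρ →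
    (1 - Complex.exp (-z)) ^ a = z ^ a * diffQuot z ^ a := by
  have ht : Tendsto diffQuot (𝓝[≠] 0) (𝓝 1) := by
    have h := diffQuot_sub_isBigO
    have hz : Tendsto (fun z : ℂ => z ^ 2) (𝓝[≠] 0) (𝓝 0) := by
      have : Tendsto (fun z : ℂ => z ^ 2) (𝓝 0) (𝓝 (0 ^ 2)) := (continuous_pow 2).tendsto 0
      simpa using this.mono_left nhdsWithin_le_nhds
    have h1 := h.trans_tendsto hz
    have h2 : Tendsto (fun z : ℂ => 1 - z / 2) (𝓝[≠] 0) (𝓝 (1 - 0 / 2)) :=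
      ((by fun_prop : Continuous fun z : ℂ => 1 - z / 2).tendsto 0).mono_left nhdsWithin_le_nhds
    have := h1.add h2
    simp only [zero_div, sub_zero, zero_add] at this
    refine this.congr fun z => ?_
    ring
  have harg : Tendsto (fun z => (diffQuot z).arg) (𝓝[≠] 0) (𝓝 0) := by
    have := (Complex.continuousAt_arg (x := 1) (by simp)).tendsto.comp ht
    simpa [Function.comp_def] using this
  have hev : ∀ᶠ z in 𝓝[≠] (0 : ℂ), |(diffQuot z).arg| < 1 ∧ diffQuot z ≠ 0 := by
    refine (harg.eventually (p := fun t : ℝ => |t| < 1) ?_).and (ht.eventually_ne one_ne_zero)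
    have : Tendsto (fun t : ℝ => |t|) (𝓝 0) (𝓝 |0|) := continuous_abs.tendsto 0
    exact this.eventually_lt_const (by simp)
  rw [eventually_nhdsWithin_iff, Metric.eventually_nhds_iff] at hev
  obtain ⟨ρ, hρ, hev⟩ := hev
  refine ⟨ρ, hρ, fun z hz hz0 hzρ => ?_⟩
  obtain ⟨h1, h2⟩ := hev (by simpa using hzρ) hz0
  have h3 : |z.arg| ≤ Real.pi / 2 := Complex.abs_arg_le_pi_div_two_iff.2 hz
  have hlog : Complex.log (z * diffQuot z) = Complex.log z + Complex.log (diffQuot z) := by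
    refine (Complex.log_mul_eq_add_log_iff hz0 h2).2 ?_
    have := abs_lt.1 h1
    have := abs_le.1 h3
    have := Real.pi_gt_three
    constructor <;> linarith
  have e : 1 - Complex.exp (-z) = z * diffQuot z := by
    rw [diffQuot]; field_simp
  rw [e, Complex.cpow_def_of_ne_zero (mul_ne_zero hz0 h2), hlog,
    Complex.cpow_def_of_ne_zero hz0, Complex.cpow_def_of_ne_zero h2, ← Complex.exp_add, add_mul]

theorem norm_one_sub_exp_neg_cpow_le {α : ℝ} (hα : 0 ≤ α) {z : ℂ} (hz : 0 ≤ z.re) :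
    ‖(1 - Complex.exp (-z)) ^ (α : ℂ)‖ ≤ 2 ^ α := by
  have h : ‖1 - Complex.exp (-z)‖ ≤ 2 := by
    refine (norm_sub_le _ _).trans ?_
    rw [norm_one, Complex.norm_exp]
    have : Real.exp (-z).re ≤ 1 := Real.exp_le_one_iff.2 (by simpa using hz)
    linarith
  rcases eq_or_ne (1 - Complex.exp (-z)) 0 with h0 | h0
  · rw [h0]
    rcases hα.eq_or_lt with rfl | hα
    · simp
    · rw [Complex.zero_cpow (by exact_mod_cast hα.ne')]
      simp; positivity
  · rw [Complex.norm_cpow_real]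
    exact Real.rpow_le_rpow (norm_nonneg _) h hα

/-- The symbol estimate behind the second-order consistency of the weighted shifted
Grünwald operator. -/
theorem exists_symbol_bound {α : ℝ} (hα : 0 < α) (r₁ r₂ r₃ : ℝ) (h₁ : r₁ = α / 2 + r₃)
    (h₂ : r₂ = (2 - α) / 2 - 2 * r₃) (M : ℝ) :
    ∃ C, 0 ≤ C ∧ ∀ z : ℂ, 0 ≤ z.re → z.re ≤ M →
      ‖z ^ (α : ℂ) - (r₁ * Complex.exp z + r₂ + r₃ * Complex.exp (-z))
        * (1 - Complex.exp (-z)) ^ (α : ℂ)‖ ≤ C * ‖z‖ ^ (α + 2) := by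
  have hO := weighted_diffQuot_isBigO α r₁ r₂ r₃ (by rw [h₁]; push_cast; rfl)
    (by rw [h₂]; push_cast; rfl)
  obtain ⟨C₁, hC₁, hb⟩ := hO.exists_pos
  have hb := hb.bound
  rw [eventually_nhdsWithin_iff, Metric.eventually_nhds_iff] at hb
  obtain ⟨ρ₁, hρ₁, hb⟩ := hb
  obtain ⟨ρ₂, hρ₂, hp⟩ := exists_one_sub_exp_neg_cpow (α : ℂ)
  set ρ := min ρ₁ ρ₂
  have hρ : 0 < ρ := lt_min hρ₁ hρ₂
  -- B bounds the discrete symbol on the whole strip. For ‖z‖ ≥ ρ, both ‖z‖^α and B are absorbed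
  -- into multiples of ‖z‖^(α+2), which gives the last two summands of the constant; C₁ serves ‖z‖ <
  -- ρ.
  set B := (|r₁| * Real.exp M + |r₂| + |r₃|) * 2 ^ α
  have hB : 0 ≤ B := by positivity
  refine ⟨C₁ + (1 / ρ ^ (2 : ℝ) + B / ρ ^ (α + 2)), by positivity, fun z hz hzM => ?_⟩
  rcases eq_or_ne z 0 with rfl | hz0
  · simp [Complex.zero_cpow (show (α : ℂ) ≠ 0 by exact_mod_cast hα.ne'),
      Real.zero_rpow (show α + 2 ≠ 0 by positivity)]
  have hzn : 0 < ‖z‖ := norm_pos_iff.2 hz0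
  have hzα : ‖z ^ (α : ℂ)‖ = ‖z‖ ^ α := Complex.norm_cpow_real _ _
  have hsplit : ‖z‖ ^ (α + 2) = ‖z‖ ^ α * ‖z‖ ^ 2 := by
    rw [Real.rpow_add hzn]; norm_num
  rcases lt_or_ge ‖z‖ ρ with hlt | hge
  · have h := hb (by simpa using hlt.trans_le (min_le_left _ _)) hz0
    rw [hp z hz hz0 (hlt.trans_le (min_le_right _ _))]
    have e : z ^ (α : ℂ) - (r₁ * Complex.exp z + r₂ + r₃ * Complex.exp (-z))
        * (z ^ (α : ℂ) * diffQuot z ^ (α : ℂ)) = -(z ^ (α : ℂ) *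
        ((r₁ * Complex.exp z + r₂ + r₃ * Complex.exp (-z)) * diffQuot z ^ (α : ℂ) - 1)) := by
      ring
    rw [e, norm_neg, norm_mul, hzα]
    calc _ ≤ ‖z‖ ^ α * (C₁ * ‖z‖ ^ 2) := by
          rw [norm_pow] at h; gcongr
      _ = C₁ * ‖z‖ ^ (α + 2) := by rw [hsplit]; ring
      _ ≤ _ := by
        gcongr
        have : 0 ≤ 1 / ρ ^ (2 : ℝ) + B / ρ ^ (α + 2) := by positivity
        linarith
  · have hE : ‖(r₁ * Complex.exp z + r₂ + r₃ * Complex.exp (-z))‖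
        ≤ |r₁| * Real.exp M + |r₂| + |r₃| := by
      refine (norm_add₃_le).trans ?_
      simp only [norm_mul, Complex.norm_real, Real.norm_eq_abs, Complex.norm_exp, Complex.neg_re]
      gcongr
      have : Real.exp (-z.re) ≤ 1 := Real.exp_le_one_iff.2 (by linarith)
      calc |r₃| * Real.exp (-z.re) ≤ |r₃| * 1 := by gcongr
        _ = _ := mul_one _
    have h1 : ‖z‖ ^ α ≤ 1 / ρ ^ (2 : ℝ) * ‖z‖ ^ (α + 2) := by
      rw [hsplit, one_div_mul_eq_div, le_div_iff₀ (by positivity)]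
      gcongr
      rw [Real.rpow_two]
      gcongr
    have h2 : B ≤ B / ρ ^ (α + 2) * ‖z‖ ^ (α + 2) := by
      rw [div_mul_eq_mul_div, le_div_iff₀ (by positivity)]
      gcongr
    have h3 := mul_le_mul hE (norm_one_sub_exp_neg_cpow_le hα.le hz) (norm_nonneg _)
      (by positivity)
    rw [← norm_mul] at h3
    calc _ ≤ ‖z‖ ^ α + B := (norm_sub_le _ _).trans (by rw [hzα]; gcongr)
      _ ≤ (1 / ρ ^ (2 : ℝ) + B / ρ ^ (α + 2)) * ‖z‖ ^ (α + 2) := by linarith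
      _ ≤ _ := mul_le_mul_of_nonneg_right (by linarith) (by positivity)

/-! ### Grünwald weights and their generating function -/

theorem grunwaldWeight_succ_mul (α : ℝ) (j : ℕ) :
    ((j : ℝ) + 1) * grunwaldWeight α (j + 1) = (j - α) * grunwaldWeight α j := by
  have : (j : ℝ) + 1 ≠ 0 := by positivity
  rw [grunwaldWeight]
  push_cast
  field_simp
  ring

theorem grunwaldWeight_nonneg {α : ℝ} (h1 : 1 ≤ α) (h2 : α ≤ 2) (j : ℕ) :
    0 ≤ grunwaldWeight α (j + 2) := by
  induction j with
  | zero =>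
    simp only [grunwaldWeight]
    norm_num
    nlinarith
  | succ k ih =>
    rw [show k + 1 + 2 = (k + 2) + 1 by ring, grunwaldWeight]
    refine mul_nonneg ?_ ih
    rw [sub_nonneg, div_le_one (by positivity)]
    push_cast
    have : (0 : ℝ) ≤ k := k.cast_nonneg
    linarith

theorem summable_grunwaldWeight {α : ℝ} (h1 : 1 ≤ α) (h2 : α ≤ 2) :
    Summable (grunwaldWeight α) := by
  rw [← summable_nat_add_iff 2]
  -- The recursion reads α g_j = j g_j - (j+1) g_{j+1}, so the sum telescopes. Nonnegativity from j
  -- = 2 on then bounds the partial sums.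
  have hsum : ∀ n : ℕ, α * ∑ j ∈ Finset.range n, grunwaldWeight α (j + 2)
      = 2 * grunwaldWeight α 2 - (n + 2) * grunwaldWeight α (n + 2) := by
    intro n
    induction n with
    | zero => simp
    | succ k ih =>
      rw [Finset.sum_range_succ, mul_add, ih]
      have := grunwaldWeight_succ_mul α (k + 2)
      rw [show k + 1 + 2 = k + 2 + 1 by ring]
      push_cast at this ⊢
      linear_combination this
  refine summable_of_sum_range_le (c := 2 * grunwaldWeight α 2 / α)
    (grunwaldWeight_nonneg h1 h2) fun n => ?_
  rw [le_div_iff₀ (by linarith), mul_comm, hsum]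
  have := mul_nonneg (by positivity : (0 : ℝ) ≤ n + 2) (grunwaldWeight_nonneg h1 h2 n)
  linarith

theorem ringChoose_succ_mul (a : ℂ) (j : ℕ) :
    ((j : ℂ) + 1) * Ring.choose a (j + 1) = (a - j) * Ring.choose a j := by
  rw [Ring.choose_eq_smul, Ring.choose_eq_smul, descPochhammer_succ_right, Polynomial.smeval_mul,
    Nat.factorial_succ]
  have h1 : (j.factorial : ℂ) ≠ 0 := by exact_mod_cast j.factorial_ne_zero
  have h2 : (j : ℂ) + 1 ≠ 0 := by exact_mod_cast j.succ_ne_zero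
  simp only [Polynomial.smeval_sub, Polynomial.smeval_X, Polynomial.smeval_natCast, smul_eq_mul]
  push_cast
  field_simp
  simp

theorem grunwaldWeight_eq_choose (α : ℝ) (j : ℕ) :
    (grunwaldWeight α j : ℂ) = (-1) ^ j * Ring.choose (α : ℂ) j := by
  induction j with
  | zero => simp [grunwaldWeight]
  | succ k ih =>
    have h0 : (k : ℂ) + 1 ≠ 0 := by exact_mod_cast k.succ_ne_zero
    refine mul_left_cancel₀ h0 ?_
    have h1 := congrArg (fun t : ℝ => (t : ℂ)) (grunwaldWeight_succ_mul α k)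
    push_cast at h1
    have h2 := ringChoose_succ_mul (α : ℂ) k
    rw [h1, ih, pow_succ]
    linear_combination (-1) ^ k * h2

theorem hasSum_grunwaldWeight_of_norm_lt_one (α : ℝ) {w : ℂ} (hw : ‖w‖ < 1) :
    HasSum (fun j => (grunwaldWeight α j : ℂ) * w ^ j) ((1 - w) ^ (α : ℂ)) := by
  have h := (Complex.one_add_cpow_hasFPowerSeriesOnBall_zero (a := (α : ℂ))).hasSum (y := -w)
    (by simpa [enorm_eq_nnnorm, ← NNReal.coe_lt_coe] using! hw)
  rw [zero_add, ← sub_eq_add_neg] at h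
  rw [show (fun j => (grunwaldWeight α j : ℂ) * w ^ j)
    = fun n => binomialSeries ℂ (α : ℂ) n fun _ => -w from ?_]
  · exact h
  funext j
  rw [grunwaldWeight_eq_choose, binomialSeries_apply]
  simp only [List.ofFn_const, List.prod_replicate, smul_eq_mul, neg_pow w]
  ring

/-- Abel's limit along r → 1⁻ carries the binomial series to the closed disc, as λ = 0 requires. The
series is dominated by ∑ |g_j|, and u ↦ u^α is continuous on Re u ≥ 0, including u = 0, because α >
0. -/
theorem tsum_grunwaldWeight {α : ℝ} (h1 : 1 ≤ α) (h2 : α ≤ 2) {w : ℂ} (hw : ‖w‖ ≤ 1) :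
    ∑' j, (grunwaldWeight α j : ℂ) * w ^ j = (1 - w) ^ (α : ℂ) := by
  have hs := (summable_grunwaldWeight h1 h2).norm
  have hseq : Tendsto (fun r : ℝ => (r : ℂ) * w) (𝓝[<] 1) (𝓝 w) := by
    have : Tendsto (fun r : ℝ => (r : ℂ) * w) (𝓝 1) (𝓝 ((1 : ℝ) * w)) :=
      (by fun_prop : Continuous fun r : ℝ => (r : ℂ) * w).tendsto 1
    simpa using this.mono_left nhdsWithin_le_nhds
  have hI : ∀ᶠ r in 𝓝[<] (1 : ℝ), r ∈ Ioo (0 : ℝ) 1 := Ioo_mem_nhdsLT one_pos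
  have hlt : ∀ r ∈ Ioo (0 : ℝ) 1, ‖(r : ℂ) * w‖ < 1 := by
    intro r hr
    rw [norm_mul, Complex.norm_real, Real.norm_eq_abs, abs_of_pos hr.1]
    calc r * ‖w‖ ≤ r * 1 := by gcongr; exact hr.1.le
      _ < 1 := by linarith [hr.2]
  have hL : Tendsto (fun r : ℝ => ∑' j, (grunwaldWeight α j : ℂ) * ((r : ℂ) * w) ^ j) (𝓝[<] 1)
      (𝓝 (∑' j, (grunwaldWeight α j : ℂ) * w ^ j)) := by
    refine tendsto_tsum_of_dominated_convergence hs (fun j => ?_) ?_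
    · exact (hseq.pow j).const_mul _
    · filter_upwards [hI] with r hr j
      rw [norm_mul, norm_pow, Complex.norm_real]
      exact mul_le_of_le_one_right (norm_nonneg _) (pow_le_one₀ (norm_nonneg _) (hlt r hr).le)
  have hR : Tendsto (fun r : ℝ => (1 - (r : ℂ) * w) ^ (α : ℂ)) (𝓝[<] 1)
      (𝓝 ((1 - w) ^ (α : ℂ))) := by
    have ht : Tendsto (fun r : ℝ => 1 - (r : ℂ) * w) (𝓝[<] 1) (𝓝 (1 - w)) := hseq.const_sub 1
    refine Tendsto.comp (f := fun r : ℝ => 1 - (r : ℂ) * w) (g := fun u : ℂ => u ^ (α : ℂ)) ?_ ht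
    refine (Complex.continuousAt_cpow_const_of_re_pos (Or.inl ?_) ?_).tendsto
    · simpa using (Complex.re_le_norm w).trans hw
    · simpa using zero_lt_one.trans_le h1
  refine tendsto_nhds_unique (hL.congr' ?_) hR
  filter_upwards [hI] with r hr
  exact (hasSum_grunwaldWeight_of_norm_lt_one α (hlt r hr)).tsum_eq

/-! ### Laplace transform of a power in the right half plane -/

theorem integrableOn_rpow_mul_exp_neg_mul {s b : ℝ} (hs : -1 < s) (hb : 0 < b) :
    IntegrableOn (fun t : ℝ => t ^ s * Real.exp (-(b * t))) (Ioi 0) := by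
  simpa using integrableOn_rpow_mul_exp_neg_mul_rpow hs one_pos hb

theorem integrableOn_rpow_mul_cexp {s : ℝ} (hs : -1 < s) {r : ℂ} (hr : 0 < r.re) :
    IntegrableOn (fun t : ℝ => ((t ^ s : ℝ) : ℂ) * Complex.exp (-(r * t))) (Ioi 0) := by
  refine Integrable.mono' (integrableOn_rpow_mul_exp_neg_mul hs hr) ?_ ?_
  · exact (by fun_prop : Measurable _).aestronglyMeasurable
  · refine (ae_restrict_mem measurableSet_Ioi).mono fun t ht => ?_
    rw [norm_mul, Complex.norm_real, Real.norm_eq_abs, abs_of_nonneg (Real.rpow_nonneg ht.le _),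
      Complex.norm_exp]
    simp

theorem differentiableAt_laplace_rpow {s : ℝ} (hs : 0 < s) {r : ℂ} (hr : 0 < r.re) :
    DifferentiableAt ℂ
      (fun r : ℂ => ∫ t in Ioi (0 : ℝ), ((t ^ (s - 1) : ℝ) : ℂ) * Complex.exp (-(r * t))) r := by
  -- Half the distance to the imaginary axis leaves decay e^{-(Re r/2)t} uniformly on the ball,
  -- which dominates the parameter derivative.
  have hball : ∀ u ∈ Metric.ball r (r.re / 2), r.re / 2 ≤ u.re := by
    intro u hu
    have h1 := (Complex.abs_re_le_norm (u - r)).trans (mem_ball_iff_norm.1 hu).le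
    rw [Complex.sub_re] at h1
    linarith [(abs_le.1 h1).1]
  refine (hasDerivAt_integral_of_dominated_loc_of_deriv_le
    (F := fun u t => ((t ^ (s - 1) : ℝ) : ℂ) * Complex.exp (-(u * t)))
    (μ := volume.restrict (Ioi 0)) (F' := fun u t => ((t ^ (s - 1) : ℝ) : ℂ) * (Complex.exp (-(u * t)) * -(t : ℂ)))
    (bound := fun t => t ^ s * Real.exp (-(r.re / 2 * t)))
    (Metric.ball_mem_nhds r (half_pos hr)) (.of_forall fun u => ?_)
    (integrableOn_rpow_mul_cexp (by linarith) hr) ?_ ?_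
    (integrableOn_rpow_mul_exp_neg_mul (by linarith) (half_pos hr)) ?_).2.differentiableAt
  · exact (by fun_prop : Measurable _).aestronglyMeasurable
  · exact (by fun_prop : Measurable _).aestronglyMeasurable
  · refine (ae_restrict_mem measurableSet_Ioi).mono fun t ht u hu => ?_
    have ht : 0 < t := ht
    rw [norm_mul, norm_mul, norm_neg, Complex.norm_real, Complex.norm_real, Real.norm_eq_abs,
      Real.norm_eq_abs, abs_of_nonneg (Real.rpow_nonneg ht.le _), abs_of_pos ht, Complex.norm_exp]
    have e : t ^ s = t ^ (s - 1) * t := by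
      rw [← Real.rpow_add_one ht.ne', sub_add_cancel]
    have e2 : Real.exp (-(u * t)).re ≤ Real.exp (-(r.re / 2 * t)) := by
      refine Real.exp_le_exp.2 ?_
      simp only [Complex.neg_re, Complex.re_mul_ofReal, neg_le_neg_iff]
      have := hball u hu
      gcongr
    calc _ ≤ t ^ (s - 1) * (Real.exp (-(r.re / 2 * t)) * t) := by gcongr
      _ = _ := by rw [e]; ring
  · refine .of_forall fun t u _ => ?_
    refine HasDerivAt.const_mul _ ?_
    have : HasDerivAt (fun u : ℂ => -(u * t)) (-(1 * (t : ℂ))) u :=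
      ((hasDerivAt_id u).mul_const (t : ℂ)).neg
    rw [one_mul] at this
    exact this.cexp

/-- The Laplace transform of a power, for complex parameters in the right half plane. -/
theorem integral_rpow_mul_cexp {s : ℝ} (hs : 0 < s) {r : ℂ} (hr : 0 < r.re) :
    ∫ t in Ioi (0 : ℝ), ((t ^ (s - 1) : ℝ) : ℂ) * Complex.exp (-(r * t))
      = (Real.Gamma s : ℂ) * r ^ (-(s : ℂ)) := by
  have hopen : IsOpen {z : ℂ | 0 < z.re} := isOpen_lt continuous_const Complex.continuous_re
  have h1 : AnalyticOnNhd ℂ (fun r : ℂ => ∫ t in Ioi (0 : ℝ),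
      ((t ^ (s - 1) : ℝ) : ℂ) * Complex.exp (-(r * t))) {z : ℂ | 0 < z.re} :=
    DifferentiableOn.analyticOnNhd
      (fun z hz => (differentiableAt_laplace_rpow hs hz).differentiableWithinAt) hopen
  have h2 : AnalyticOnNhd ℂ (fun r : ℂ => (Real.Gamma s : ℂ) * r ^ (-(s : ℂ)))
      {z : ℂ | 0 < z.re} := by
    refine DifferentiableOn.analyticOnNhd (fun z hz => ?_) hopen
    refine (DifferentiableAt.const_mul ?_ _).differentiableWithinAt
    exact (differentiableAt_id).cpow_const (Or.inl hz)
  have hpre : IsPreconnected {z : ℂ | 0 < z.re} :=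
    (convex_halfSpace_re_gt 0).isPreconnected
  have hreal : ∀ x : ℝ, 0 < x → ∫ t in Ioi (0 : ℝ),
      ((t ^ (s - 1) : ℝ) : ℂ) * Complex.exp (-((x : ℂ) * t))
      = (Real.Gamma s : ℂ) * (x : ℂ) ^ (-(s : ℂ)) := by
    intro x hx
    have := Complex.integral_cpow_mul_exp_neg_mul_Ioi (a := (s : ℂ)) (by simpa using hs) hx
    rw [Complex.Gamma_ofReal, one_div, Complex.inv_cpow _ _
      (by rw [Complex.arg_ofReal_of_nonneg hx.le]; exact Real.pi_pos.ne), ← Complex.cpow_neg] at this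
    rw [mul_comm, ← this]
    refine setIntegral_congr_fun measurableSet_Ioi fun t ht => ?_
    rw [Complex.ofReal_cpow (le_of_lt ht)]
    push_cast
    rfl
  -- Identity theorem: both sides are analytic and agree at the real points 1 + 1/(n+1), which
  -- accumulate at 1.
  refine h1.eqOn_of_preconnected_of_frequently_eq h2 hpre (z₀ := 1) (by simp) ?_ hr
  have ht : Tendsto (fun n : ℕ => ((1 + 1 / ((n : ℝ) + 1) : ℝ) : ℂ)) atTop (𝓝[≠] 1) := by
    refine tendsto_nhdsWithin_iff.2 ⟨?_, .of_forall fun n => ?_⟩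
    · have := (tendsto_one_div_add_atTop_nhds_zero_nat (𝕜 := ℝ)).const_add 1
      rw [add_zero] at this
      exact_mod_cast (Complex.continuous_ofReal.tendsto (1 : ℝ)).comp this
    · have : (0 : ℝ) < 1 / ((n : ℝ) + 1) := by positivity
      simp only [mem_compl_iff, mem_singleton_iff]
      rw [← Complex.ofReal_one, Complex.ofReal_inj]
      linarith
  refine ht.frequently (Frequently.of_forall fun n => ?_)
  exact hreal _ (by positivity)

/-! ### Exponential integrals and the Riemann–Liouville multiplier -/

/-- The symbol `λ - iω`. -/
noncomputable def freq (lam w : ℝ) : ℂ := lam - Complex.I * w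

@[simp] theorem freq_re (lam w : ℝ) : (freq lam w).re = lam := by simp [freq]

@[simp] theorem freq_im (lam w : ℝ) : (freq lam w).im = -w := by simp [freq]

@[fun_prop] theorem continuous_freq (lam : ℝ) : Continuous (freq lam) := by
  unfold freq; fun_prop

/-- The exponential integral `∫ e^{(λ - iω) x} g(ω) dω`. -/
noncomputable def expInt (lam : ℝ) (g : ℝ → ℂ) (x : ℝ) : ℂ :=
  ∫ w : ℝ, Complex.exp (freq lam w * x) * g w

theorem norm_exp_freq_mul (lam w x : ℝ) :
    ‖Complex.exp (freq lam w * x)‖ = Real.exp (lam * x) := by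
  rw [Complex.norm_exp]; simp

theorem integrable_exp_freq_mul {lam : ℝ} {g : ℝ → ℂ} (hg : Integrable g) (x : ℝ) :
    Integrable fun w => Complex.exp (freq lam w * x) * g w :=
  hg.bdd_mul (c := Real.exp (lam * x)) (by fun_prop : Continuous _).aestronglyMeasurable
    (.of_forall fun w => (norm_exp_freq_mul lam w x).le)

theorem expInt_eq (lam : ℝ) (g : ℝ → ℂ) (x : ℝ) :
    expInt lam g x = Real.exp (lam * x) * ∫ w : ℝ, Complex.exp (-(Complex.I * w * x)) * g w := by
  rw [expInt, ← integral_const_mul]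
  refine integral_congr_ae (.of_forall fun w => ?_)
  simp only
  rw [← mul_assoc, Complex.ofReal_exp, ← Complex.exp_add, freq]
  congr 2
  push_cast
  ring

theorem ae_eq_zero_of_expInt_eq_zero {lam : ℝ} {g : ℝ → ℂ} (hg : Integrable g)
    (h : ∀ x, expInt lam g x = 0) : g =ᵐ[volume] 0 := by
  refine ae_eq_zero_of_integral_exp_eq_zero hg fun x => ?_
  have := h x
  rw [expInt_eq] at this
  exact (mul_eq_zero.1 this).resolve_left (by exact_mod_cast (Real.exp_pos _).ne')

theorem freq_mem_slitPlane {lam w : ℝ} (hw : w ≠ 0) : freq lam w ∈ Complex.slitPlane :=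
  Or.inr (by simpa using hw)

/-- Near 0 the singularity is integrable because s < 1 and g is bounded; for |w| ≥ 1 the weight is
at most 1. -/
theorem integrable_abs_rpow_neg_mul {s : ℝ} (hs0 : 0 < s) (hs1 : s < 1) {g : ℝ → ℂ}
    (hg : Integrable g) {B : ℝ} (hB : ∀ w, ‖g w‖ ≤ B) :
    Integrable fun w : ℝ => |w| ^ (-s) * ‖g w‖ := by
  have h1 : IntegrableOn (fun w : ℝ => |w| ^ (-s)) (Icc (-1) 1) := by
    have hr : IntegrableOn (fun w : ℝ => |w| ^ (-s)) (Ioc 0 1) := by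
      have := (intervalIntegral.intervalIntegrable_rpow' (a := 0) (b := 1)
        (show -1 < -s by linarith)).1
      refine this.congr_fun (fun w hw => ?_) measurableSet_Ioc
      simp only [abs_of_pos hw.1]
    have h01 : IntervalIntegrable (fun w : ℝ => |w| ^ (-s)) volume 0 1 :=
      (intervalIntegrable_iff_integrableOn_Ioc_of_le zero_le_one).2 hr
    have h10 : IntervalIntegrable (fun w : ℝ => |w| ^ (-s)) volume (-1) 0 := by
      rw [IntervalIntegrable.iff_comp_neg]
      simpa using h01.symm
    rw [integrableOn_Icc_iff_integrableOn_Ioc]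
    exact (h10.trans h01).1
  have h2 : Integrable (fun w : ℝ => (Icc (-1) 1).indicator (fun w : ℝ => |w| ^ (-s)) w * B) :=
    (h1.integrable_indicator measurableSet_Icc).mul_const B
  refine Integrable.mono' (h2.add hg.norm) ?_ (.of_forall fun w => ?_)
  · exact ((by fun_prop : Measurable fun w : ℝ => |w| ^ (-s)).aestronglyMeasurable).mul
      hg.norm.aestronglyMeasurable
  · have hn : 0 ≤ |w| ^ (-s) := by positivity
    rw [Real.norm_of_nonneg (by positivity)]
    simp only [Pi.add_apply]
    by_cases hw : w ∈ Icc (-1 : ℝ) 1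
    · rw [indicator_of_mem hw]
      have := hB w
      have : |w| ^ (-s) * ‖g w‖ ≤ |w| ^ (-s) * B := by gcongr
      linarith [norm_nonneg (g w)]
    · rw [indicator_of_notMem hw, zero_mul, zero_add]
      have : 1 ≤ |w| := by
        by_contra hlt
        exact hw (abs_le.1 (not_le.1 hlt).le)
      exact mul_le_of_le_one_left (norm_nonneg _)
        (Real.rpow_le_one_of_one_le_of_nonpos this (by linarith))

/-- The imaginary part -w does not depend on ε or λ, so this majorant is uniform as ε → 0 and
survives λ = 0. -/
theorem norm_cpow_neg_le {s : ℝ} (hs : 0 ≤ s) {lam ε w : ℝ} (hw : w ≠ 0) :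
    ‖(freq lam w + ε) ^ (-(s : ℂ))‖ ≤ |w| ^ (-s) := by
  have him : (freq lam w + ε).im = -w := by simp
  have h0 : freq lam w + ε ≠ 0 := fun h => hw (by simpa [h] using him)
  rw [show (-(s : ℂ)) = ((-s : ℝ) : ℂ) by push_cast; rfl, Complex.norm_cpow_real]
  refine Real.rpow_le_rpow_of_nonpos (abs_pos.2 hw) ?_ (by linarith)
  have := Complex.abs_im_le_norm (freq lam w + ε)
  rwa [him, abs_neg] at this

theorem aestronglyMeasurable_freq_cpow (lam ε : ℝ) (a : ℂ) :
    AEStronglyMeasurable (fun w : ℝ => (freq lam w + ε) ^ a) volume := by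
  have h1 : Measurable (freq lam) := (continuous_freq lam).measurable
  exact ((h1.add_const _).pow_const a).aestronglyMeasurable

theorem ae_ne_zero_real : ∀ᵐ w : ℝ, w ≠ 0 := by
  simp [ae_iff, measure_singleton]

theorem integrable_freq_cpow_neg_mul {s : ℝ} (hs0 : 0 < s) (hs1 : s < 1) (lam ε : ℝ) {g : ℝ → ℂ}
    (hg : Integrable g) {B : ℝ} (hB : ∀ w, ‖g w‖ ≤ B) :
    Integrable fun w : ℝ => (freq lam w + ε) ^ (-(s : ℂ)) * g w := by
  refine Integrable.mono' (integrable_abs_rpow_neg_mul hs0 hs1 hg hB)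
    ((aestronglyMeasurable_freq_cpow _ _ _).mul hg.aestronglyMeasurable) ?_
  filter_upwards [ae_ne_zero_real] with w hw
  rw [norm_mul]
  gcongr
  exact norm_cpow_neg_le hs0.le hw

theorem indicator_Iio_comp_sub_left (f : ℝ → ℂ) (x t : ℝ) :
    (Iio x).indicator f (x - t) = (Ioi 0).indicator (fun t => f (x - t)) t := by
  by_cases h : 0 < t
  · rw [indicator_of_mem (by simpa using h), indicator_of_mem (by simpa using h)]
  · rw [indicator_of_notMem (by simpa using h), indicator_of_notMem (by simpa using h)]

theorem setIntegral_Iio_comp_sub_left (f : ℝ → ℂ) (x : ℝ) :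
    ∫ y in Iio x, f y = ∫ t in Ioi (0 : ℝ), f (x - t) := by
  rw [← integral_indicator measurableSet_Iio, ← integral_sub_left_eq_self _ volume x,
    ← integral_indicator measurableSet_Ioi]
  exact integral_congr_ae (.of_forall fun t => indicator_Iio_comp_sub_left f x t)

theorem integrableOn_Ioi_comp_sub_left {f : ℝ → ℂ} {x : ℝ} (hf : IntegrableOn f (Iio x)) :
    IntegrableOn (fun t => f (x - t)) (Ioi 0) := by
  rw [← integrable_indicator_iff measurableSet_Iio] at hf
  rw [← integrable_indicator_iff measurableSet_Ioi]
  exact (hf.comp_sub_left x).congr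
    (.of_forall fun t => indicator_Iio_comp_sub_left f x t)

/-- The damping e^{-εt} supplies the absolute convergence that Fubini needs: t^{s-1} alone is not
integrable at infinity, and λ = 0 gives no decay. The inner integral is then a Laplace transform at
λ - iω + ε. -/
theorem integral_rpow_mul_exp_mul_expInt {s : ℝ} (hs : 0 < s) {lam : ℝ} (hlam : 0 ≤ lam) {ε : ℝ}
    (hε : 0 < ε) {g : ℝ → ℂ} (hg : Integrable g) (x : ℝ) :
    ∫ t in Ioi (0 : ℝ), (Real.exp (-(ε * t)) : ℂ) * (((t ^ (s - 1) : ℝ) : ℂ) *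
        expInt lam g (x - t))
      = (Real.Gamma s : ℂ) *
        ∫ w : ℝ, Complex.exp (freq lam w * x) * ((freq lam w + ε) ^ (-(s : ℂ)) * g w) := by
  set k : ℝ → ℂ := fun t => ((t ^ (s - 1) * Real.exp (-(ε * t)) : ℝ) : ℂ) with hk
  have hkint : Integrable k (volume.restrict (Ioi 0)) :=
    (integrableOn_rpow_mul_exp_neg_mul (by linarith) hε).ofReal
  have hprod : Integrable (fun p : ℝ × ℝ =>
      Complex.exp (freq lam p.2 * ((x - p.1 : ℝ) : ℂ)) * (k p.1 * g p.2))
      ((volume.restrict (Ioi 0)).prod volume) := by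
    refine (hkint.mul_prod hg).bdd_mul (c := Real.exp (lam * x)) ?_ ?_
    · exact (by fun_prop : Continuous _).aestronglyMeasurable
    · rw [← Measure.restrict_univ (μ := (volume : Measure ℝ)), Measure.restrict_restrict (by simp),
        Measure.prod_restrict]
      refine (ae_restrict_mem (by measurability)).mono fun p hp => ?_
      rw [norm_exp_freq_mul]
      refine Real.exp_le_exp.2 ?_
      have : 0 < p.1 := by simpa using hp
      nlinarith
  calc _ = ∫ t in Ioi (0 : ℝ), ∫ w : ℝ,
        Complex.exp (freq lam w * ((x - t : ℝ) : ℂ)) * (k t * g w) := by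
        refine integral_congr_ae (.of_forall fun t => ?_)
        simp only [expInt, hk]
        rw [← mul_assoc, ← integral_const_mul]
        refine integral_congr_ae (.of_forall fun w => ?_)
        push_cast
        ring
    _ = ∫ w : ℝ, ∫ t in Ioi (0 : ℝ),
        Complex.exp (freq lam w * ((x - t : ℝ) : ℂ)) * (k t * g w) := integral_integral_swap hprod
    _ = _ := by
        rw [← integral_const_mul]
        refine integral_congr_ae (.of_forall fun w => ?_)
        simp only
        have h := integral_rpow_mul_cexp hs (r := freq lam w + ε) (by simp; linarith)
        have e : (Real.Gamma s : ℂ) * (Complex.exp (freq lam w * x) *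
            ((freq lam w + ε) ^ (-(s : ℂ)) * g w)) = Complex.exp (freq lam w * x) * g w *
            ((Real.Gamma s : ℂ) * (freq lam w + ε) ^ (-(s : ℂ))) := by ring
        rw [e, ← h, ← integral_const_mul]
        refine integral_congr_ae (.of_forall fun t => ?_)
        simp only [hk]
        rw [show -((freq lam w + ε) * (t : ℂ)) = -(freq lam w * t) + -(ε * t) by ring,
          show freq lam w * ((x - t : ℝ) : ℂ) = freq lam w * x + -(freq lam w * t) by
            push_cast; ring, Complex.exp_add, Complex.exp_add]
        push_cast
        ring

/-- The Riemann–Liouville integral of an exponential integral acts as the multiplier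
`(λ - iω)^{-s}` on the density. -/
theorem leftRLIntegral_eq_expInt {s : ℝ} (hs0 : 0 < s) (hs1 : s < 1) {lam : ℝ} (hlam : 0 ≤ lam)
    {g : ℝ → ℂ} (hg : Integrable g) {B : ℝ} (hB : ∀ w, ‖g w‖ ≤ B) {F : ℝ → ℂ}
    (hF : ∀ᵐ y, F y = expInt lam g y) {x : ℝ} (hint : IntegrableOn (rlIntegrand s F x) (Iio x)) :
    leftRLIntegral s F x = expInt lam (fun w => freq lam w ^ (-(s : ℂ)) * g w) x := by
  have hH := integrableOn_Ioi_comp_sub_left hint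
  rw [leftRLIntegral, setIntegral_Iio_comp_sub_left]
  have hF' : ∀ᵐ t ∂(volume.restrict (Ioi (0 : ℝ))), rlIntegrand s F x (x - t)
      = ((t ^ (s - 1) : ℝ) : ℂ) * expInt lam g (x - t) := by
    have hq : ∀ᵐ t, F (x - t) = expInt lam g (x - t) :=
      (Measure.measurePreserving_sub_left volume x).quasiMeasurePreserving.ae hF
    refine ae_restrict_of_ae (hq.mono fun t ht => ?_)
    rw [rlIntegrand, sub_sub_cancel, ht]
  have hH' := hH.congr hF'
  rw [integral_congr_ae hF']
  have hε : ∀ᶠ ε in 𝓝[>] (0 : ℝ), 0 < ε := self_mem_nhdsWithin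
  -- Let ε → 0⁺ on both sides of the damped identity. The left side is dominated thanks to the
  -- assumed absolute convergence at x, the right side by |w|^{-s}‖g w‖.
  have hL : Tendsto (fun ε : ℝ => ∫ t in Ioi (0 : ℝ), (Real.exp (-(ε * t)) : ℂ) *
      (((t ^ (s - 1) : ℝ) : ℂ) * expInt lam g (x - t))) (𝓝[>] 0)
      (𝓝 (∫ t in Ioi (0 : ℝ), ((t ^ (s - 1) : ℝ) : ℂ) * expInt lam g (x - t))) := by
    refine tendsto_integral_filter_of_dominated_convergence _ (.of_forall fun ε => ?_) ?_
      hH'.norm (.of_forall fun t => ?_)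
    · exact (by fun_prop : Continuous _).aestronglyMeasurable.mul hH'.aestronglyMeasurable
    · filter_upwards [hε] with ε hε
      refine (ae_restrict_mem measurableSet_Ioi).mono fun t ht => ?_
      have ht : 0 < t := ht
      rw [norm_mul, Complex.norm_real, Real.norm_eq_abs, Real.abs_exp]
      exact mul_le_of_le_one_left (norm_nonneg _) (Real.exp_le_one_iff.2 (by
        have := mul_pos hε ht; linarith))
    · have : Tendsto (fun ε : ℝ => (Real.exp (-(ε * t)) : ℂ)) (𝓝[>] 0) (𝓝 1) := by
        have h := (by fun_prop : Continuous fun ε : ℝ => (Real.exp (-(ε * t)) : ℂ)).tendsto 0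
        simpa using h.mono_left nhdsWithin_le_nhds
      simpa using this.mul_const (((t ^ (s - 1) : ℝ) : ℂ) * expInt lam g (x - t))
  have hR : Tendsto (fun ε : ℝ => (Real.Gamma s : ℂ) * ∫ w : ℝ, Complex.exp (freq lam w * x) *
      ((freq lam w + ε) ^ (-(s : ℂ)) * g w)) (𝓝[>] 0)
      (𝓝 ((Real.Gamma s : ℂ) * expInt lam (fun w => freq lam w ^ (-(s : ℂ)) * g w) x)) := by
    refine Tendsto.const_mul _ ?_
    refine tendsto_integral_filter_of_dominated_convergence
      (fun w => Real.exp (lam * x) * (|w| ^ (-s) * ‖g w‖)) (.of_forall fun ε => ?_)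
      (.of_forall fun ε => ?_) ((integrable_abs_rpow_neg_mul hs0 hs1 hg hB).const_mul _) ?_
    · exact (integrable_exp_freq_mul
        (integrable_freq_cpow_neg_mul hs0 hs1 lam ε hg hB) x).aestronglyMeasurable
    · filter_upwards [ae_ne_zero_real] with w hw
      rw [norm_mul, norm_mul, norm_exp_freq_mul]
      gcongr
      exact norm_cpow_neg_le hs0.le hw
    · filter_upwards [ae_ne_zero_real] with w hw
      refine Tendsto.const_mul _ (Tendsto.mul_const _ ?_)
      have h1 : Tendsto (fun ε : ℝ => freq lam w + ε) (𝓝[>] 0) (𝓝 (freq lam w)) := by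
        have h := (by fun_prop : Continuous fun ε : ℝ => freq lam w + ε).tendsto 0
        simpa using h.mono_left nhdsWithin_le_nhds
      exact ((continuousAt_cpow_const (freq_mem_slitPlane hw)).tendsto).comp h1
  have heq := tendsto_nhds_unique (hL.congr' (hε.mono fun ε hε =>
    integral_rpow_mul_exp_mul_expInt hs0 hlam hε hg x)) hR
  rw [heq, ← mul_assoc]
  have hΓ : (Real.Gamma s : ℂ) ≠ 0 := by exact_mod_cast (Real.Gamma_pos_of_pos hs0).ne'
  push_cast
  rw [one_div, inv_mul_cancel₀ hΓ, one_mul]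

/-! ### Bounds, continuity and differentiation of exponential integrals -/

theorem norm_integral_exp_mul_le (g : ℝ → ℂ) (x : ℝ) :
    ‖∫ w : ℝ, Complex.exp (-(Complex.I * w * x)) * g w‖ ≤ ∫ w, ‖g w‖ := by
  refine (norm_integral_le_integral_norm _).trans_eq (integral_congr_ae (.of_forall fun w => ?_))
  simp [Complex.norm_exp]

theorem continuous_integral_exp_mul {g : ℝ → ℂ} (hg : Integrable g) :
    Continuous fun x : ℝ => ∫ w : ℝ, Complex.exp (-(Complex.I * w * x)) * g w := by
  refine continuous_of_dominated (bound := fun w => ‖g w‖) (fun x => ?_) (fun x => ?_) hg.norm ?_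
  · exact (by fun_prop : Continuous _).aestronglyMeasurable.mul hg.aestronglyMeasurable
  · exact .of_forall fun w => by simp [Complex.norm_exp]
  · exact .of_forall fun w => by fun_prop

theorem norm_fourierHat_le (G : ℝ → ℂ) (w : ℝ) : ‖fourierHat G w‖ ≤ ∫ x, ‖G x‖ := by
  refine (norm_integral_le_integral_norm _).trans_eq (integral_congr_ae (.of_forall fun x => ?_))
  simp [Complex.norm_exp]

theorem fourierHat_add_const_mul {f g : ℝ → ℂ} (hf : Integrable f) (hg : Integrable g) (c : ℂ)
    (w : ℝ) : fourierHat (fun x => f x + c * g x) w = fourierHat f w + c * fourierHat g w := by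
  have hi : ∀ {k : ℝ → ℂ}, Integrable k →
      Integrable fun x : ℝ => Complex.exp (Complex.I * w * x) * k x := fun hk =>
    hk.bdd_mul (c := 1) (by fun_prop : Continuous _).aestronglyMeasurable
      (.of_forall fun x => by simp [Complex.norm_exp])
  rw [fourierHat, fourierHat, fourierHat, ← integral_const_mul, ← integral_add (hi hf)
    ((hi hg).const_mul c)]
  refine integral_congr_ae (.of_forall fun x => ?_)
  ring

theorem continuous_expInt {lam : ℝ} {g : ℝ → ℂ} (hg : Integrable g) :
    Continuous (expInt lam g) := by
  rw [show expInt lam g = _ from funext (expInt_eq lam g)]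
  exact (by fun_prop : Continuous _).mul (continuous_integral_exp_mul hg)

theorem hasDerivAt_expInt {lam : ℝ} {g : ℝ → ℂ} (hg : Integrable g)
    (hg' : Integrable fun w => freq lam w * g w) (x : ℝ) :
    HasDerivAt (expInt lam g) (expInt lam (fun w => freq lam w * g w) x) x := by
  refine (hasDerivAt_integral_of_dominated_loc_of_deriv_le (μ := volume)
    (F := fun (y : ℝ) w => Complex.exp (freq lam w * y) * g w)
    (F' := fun (y : ℝ) w => Complex.exp (freq lam w * y) * (freq lam w * g w))
    (bound := fun w => Real.exp (|lam| * (|x| + 1)) * ‖freq lam w * g w‖)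
    (Metric.ball_mem_nhds x one_pos)
    (.of_forall fun y => (integrable_exp_freq_mul hg y).aestronglyMeasurable)
    (integrable_exp_freq_mul hg x) (integrable_exp_freq_mul hg' x).aestronglyMeasurable
    (.of_forall fun w y hy => ?_) (hg'.norm.const_mul _) (.of_forall fun w y _ => ?_)).2
  · rw [norm_mul, norm_exp_freq_mul]
    refine mul_le_mul_of_nonneg_right (Real.exp_le_exp.2 ?_) (norm_nonneg _)
    have h1 : |y| ≤ |x| + 1 := by
      have h2 : |y - x| < 1 := by simpa [Real.dist_eq] using hy
      have := abs_add_le x (y - x)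
      rw [add_sub_cancel] at this
      linarith
    calc lam * y ≤ |lam * y| := le_abs_self _
      _ = |lam| * |y| := abs_mul _ _
      _ ≤ _ := by gcongr
  · have h : HasDerivAt (fun y : ℝ => freq lam w * (y : ℂ)) (freq lam w * 1) y :=
      (Complex.ofRealCLM.hasDerivAt (x := y)).const_mul _
    have := h.cexp.mul_const (g w)
    rw [mul_one, mul_assoc] at this
    exact this

/-! ### Backward differences and identification of the density -/

theorem diffQuot_eq_intervalIntegral {z : ℂ} (hz : z ≠ 0) :
    diffQuot z = ∫ s in (0 : ℝ)..1, Complex.exp (-z * s) := by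
  rw [integral_exp_mul_complex (neg_ne_zero.2 hz), diffQuot]
  simp only [Complex.ofReal_one, mul_one, Complex.ofReal_zero, mul_zero, Complex.exp_zero]
  rw [div_neg, ← neg_div, neg_sub]

theorem norm_diffQuot_le_one {z : ℂ} (hz : 0 ≤ z.re) : ‖diffQuot z‖ ≤ 1 := by
  rcases eq_or_ne z 0 with rfl | h0
  · simp [diffQuot]
  rw [diffQuot_eq_intervalIntegral h0]
  have := intervalIntegral.norm_integral_le_of_norm_le_const (a := 0) (b := 1) (C := 1)
    (f := fun s : ℝ => Complex.exp (-z * s)) ?_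
  · simpa using this
  · intro s hs
    rw [uIoc_of_le zero_le_one] at hs
    rw [Complex.norm_exp, Real.exp_le_one_iff]
    have : 0 ≤ z.re * s := mul_nonneg hz hs.1.le
    simpa using this

theorem measurable_diffQuot_freq (lam : ℝ) : Measurable fun w => diffQuot (freq lam w) := by
  have := (continuous_freq lam).measurable
  unfold diffQuot
  fun_prop

theorem integrable_diffQuot_mul {lam : ℝ} (hlam : 0 ≤ lam) {g : ℝ → ℂ} (hg : Integrable g) :
    Integrable fun w => diffQuot (freq lam w) * g w :=
  hg.bdd_mul (c := 1) (measurable_diffQuot_freq lam).aestronglyMeasurable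
    (.of_forall fun w => norm_diffQuot_le_one (by simpa using hlam))

/-- The backward difference with unit step. -/
noncomputable def backDiff (F : ℝ → ℂ) (x : ℝ) : ℂ := F x - F (x - 1)

theorem hasDerivAt_backDiff {F F' : ℝ → ℂ} (h : ∀ x, HasDerivAt F (F' x) x) (x : ℝ) :
    HasDerivAt (backDiff F) (backDiff F' x) x :=
  (h x).sub ((h (x - 1)).comp_sub_const x 1)

theorem freq_ne_zero {lam w : ℝ} (hw : w ≠ 0) : freq lam w ≠ 0 :=
  Complex.slitPlane_ne_zero (freq_mem_slitPlane hw)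

/-- The fundamental theorem of calculus and Fubini reduce this to ∫ e^{zy} dy over [x-1, x], which
is e^{zx} `diffQuot` z. An almost everywhere formula for F' thus becomes an everywhere formula for a
difference of F, with no decay of g beyond integrability. -/
theorem backDiff_eq_expInt {lam : ℝ} {g : ℝ → ℂ} (hg : Integrable g)
    {F F' : ℝ → ℂ} (h : ∀ x, HasDerivAt F (F' x) x) (hF' : F' =ᵐ[volume] expInt lam g) (x : ℝ) :
    backDiff F x = expInt lam (fun w => diffQuot (freq lam w) * g w) x := by
  have hle : x - 1 ≤ x := by linarith
  have hint : IntervalIntegrable F' volume (x - 1) x :=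
    ((continuous_expInt hg).intervalIntegrable _ _).congr_ae (ae_restrict_of_ae hF'.symm)
  rw [backDiff, ← intervalIntegral.integral_eq_sub_of_hasDerivAt (fun y _ => h y) hint,
    intervalIntegral.integral_congr_ae (hF'.mono fun y hy _ => hy),
    intervalIntegral.integral_of_le hle]
  have hprod : Integrable (fun p : ℝ × ℝ => Complex.exp (freq lam p.2 * p.1) * (1 * g p.2))
      ((volume.restrict (Ioc (x - 1) x)).prod volume) := by
    have h1 : Integrable (fun _ : ℝ => (1 : ℂ)) (volume.restrict (Ioc (x - 1) x)) :=
      integrable_const _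
    refine (h1.mul_prod hg).bdd_mul (c := Real.exp (|lam| * (|x| + 1))) ?_ ?_
    · exact (by fun_prop : Continuous _).aestronglyMeasurable
    · rw [← Measure.restrict_univ (μ := (volume : Measure ℝ)), Measure.restrict_restrict (by simp),
        Measure.prod_restrict]
      refine (ae_restrict_mem (by measurability)).mono fun p hp => ?_
      rw [norm_exp_freq_mul]
      refine Real.exp_le_exp.2 ?_
      have hp : x - 1 < p.1 ∧ p.1 ≤ x := by simpa using hp
      calc lam * p.1 ≤ |lam * p.1| := le_abs_self _
        _ = |lam| * |p.1| := abs_mul _ _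
        _ ≤ _ := by
          gcongr
          have := le_abs_self x
          have := neg_abs_le x
          exact abs_le.2 ⟨by linarith, by linarith⟩
  simp only [expInt]
  have hswap := integral_integral_swap (f := fun (y w : ℝ) =>
    Complex.exp (freq lam w * y) * (1 * g w)) hprod
  simp only [one_mul] at hswap
  rw [hswap]
  refine integral_congr_ae ?_
  filter_upwards [ae_ne_zero_real] with w hw
  have hz := freq_ne_zero (lam := lam) hw
  rw [integral_mul_const, ← intervalIntegral.integral_of_le hle, integral_exp_mul_complex hz,
    diffQuot]
  have : Complex.exp (freq lam w * ((x - 1 : ℝ) : ℂ))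
      = Complex.exp (freq lam w * x) * Complex.exp (-freq lam w) := by
    rw [← Complex.exp_add]; push_cast; ring_nf
  rw [this]
  field_simp

theorem backDiff_expInt {lam : ℝ} {g : ℝ → ℂ} (hg : Integrable g) (x : ℝ) :
    backDiff (expInt lam g) x = expInt lam (fun w => (1 - Complex.exp (-freq lam w)) * g w) x := by
  rw [backDiff, expInt, expInt, ← integral_sub (integrable_exp_freq_mul hg _)
    (integrable_exp_freq_mul hg _)]
  refine integral_congr_ae (.of_forall fun w => ?_)
  simp only
  have : Complex.exp (freq lam w * ((x - 1 : ℝ) : ℂ))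
      = Complex.exp (freq lam w * x) * Complex.exp (-freq lam w) := by
    rw [← Complex.exp_add]; push_cast; ring_nf
  rw [this]
  ring

theorem integrable_one_sub_exp_mul {lam : ℝ} {g : ℝ → ℂ} (hg : Integrable g) :
    Integrable fun w => (1 - Complex.exp (-freq lam w)) * g w := by
  refine hg.bdd_mul (c := 1 + Real.exp (-lam)) (by fun_prop : Continuous _).aestronglyMeasurable
    (.of_forall fun w => ?_)
  refine (norm_sub_le _ _).trans_eq ?_
  simp [Complex.norm_exp]

/-- Lets the factor 1 - e^{-z} be divided out: it can vanish only for ω in the countable set 2πℤ. -/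
theorem ae_exp_neg_freq_ne_one (lam : ℝ) : ∀ᵐ w : ℝ, Complex.exp (-freq lam w) ≠ 1 := by
  have hc : (range fun n : ℤ => (n : ℝ) * (2 * Real.pi)).Countable := countable_range _
  filter_upwards [hc.ae_notMem volume] with w hw h
  obtain ⟨n, hn⟩ := Complex.exp_eq_one_iff.1 h
  refine hw ⟨n, ?_⟩
  have := congrArg Complex.im hn
  simpa using this.symm

theorem ae_eq_of_expInt_eq {lam : ℝ} {f g : ℝ → ℂ} (hf : Integrable f) (hg : Integrable g)
    (h : ∀ x, expInt lam f x = expInt lam g x) : f =ᵐ[volume] g := by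
  have := ae_eq_zero_of_expInt_eq_zero (lam := lam) (hf.sub hg) fun x => ?_
  · exact this.mono fun w hw => sub_eq_zero.1 hw
  · rw [← sub_eq_zero.2 (h x), expInt, expInt, expInt,
      ← integral_sub (integrable_exp_freq_mul hf _) (integrable_exp_freq_mul hg _)]
    exact integral_congr_ae (.of_forall fun w => by simp [mul_sub])

/-- If an exponential integral with density `φ` has a fourth derivative which is almost everywhere
an exponential integral with density `g`, then `g` is `(λ - iω)⁴ φ`. -/
theorem ae_eq_freq_pow_four_mul {lam : ℝ} (hlam : 0 ≤ lam) {φ g : ℝ → ℂ} (hφ : Integrable φ)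
    (hg : Integrable g) {F₁ F₂ F₃ F₄ : ℝ → ℂ} (h₁ : ∀ x, HasDerivAt (expInt lam φ) (F₁ x) x)
    (h₂ : ∀ x, HasDerivAt F₁ (F₂ x) x) (h₃ : ∀ x, HasDerivAt F₂ (F₃ x) x)
    (h₄ : ∀ x, HasDerivAt F₃ (F₄ x) x) (hF₄ : F₄ =ᵐ[volume] expInt lam g) :
    ∀ᵐ w : ℝ, g w = freq lam w ^ 4 * φ w := by
  have i1 := integrable_diffQuot_mul hlam hg
  have i2 := integrable_diffQuot_mul hlam i1
  have i3 := integrable_diffQuot_mul hlam i2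
  have i4 := integrable_diffQuot_mul hlam i3
  have e3 := fun x => backDiff_eq_expInt hg h₄ hF₄ x
  -- Differences commute with derivatives, so each further difference descends one derivative and
  -- gains one bounded factor `diffQuot`.
  have e2 := fun x => backDiff_eq_expInt i1 (hasDerivAt_backDiff h₃) (.of_forall e3) x
  have e1 := fun x => backDiff_eq_expInt i2 (hasDerivAt_backDiff (hasDerivAt_backDiff h₂))
    (.of_forall e2) x
  have e0 := fun x => backDiff_eq_expInt i3
    (hasDerivAt_backDiff (hasDerivAt_backDiff (hasDerivAt_backDiff h₁))) (.of_forall e1) x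
  have j1 := integrable_one_sub_exp_mul (lam := lam) hφ
  have j2 := integrable_one_sub_exp_mul (lam := lam) j1
  have j3 := integrable_one_sub_exp_mul (lam := lam) j2
  have j4 := integrable_one_sub_exp_mul (lam := lam) j3
  -- The fourth difference of `expInt lam φ`, computed directly, has density (1 - e^{-z})⁴φ; through
  -- the derivatives it has density ((1 - e^{-z})/z)⁴g. Uniqueness equates them.
  have hfin := ae_eq_of_expInt_eq j4 i4 fun x => by
    have := e0 x
    rwa [show backDiff (expInt lam φ) = _ from funext (backDiff_expInt hφ),
      show backDiff (expInt lam _) = _ from funext (backDiff_expInt j1),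
      show backDiff (expInt lam _) = _ from funext (backDiff_expInt j2),
      backDiff_expInt j3] at this
  filter_upwards [hfin, ae_exp_neg_freq_ne_one lam, ae_ne_zero_real] with w hw h1 h0
  have hz := freq_ne_zero (lam := lam) h0
  have h2 : (1 - Complex.exp (-freq lam w)) ^ 4 ≠ 0 := pow_ne_zero _ (sub_ne_zero.2 h1.symm)
  simp only [diffQuot] at hw
  field_simp at hw
  exact hw.symm

/-! ### The density of G and the derivative of order α -/

theorem rlOrder_eq_two {α : ℝ} (h1 : 1 < α) (h2 : α < 2) : rlOrder α = 2 := by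
  have : ⌊α⌋₊ = 1 := (Nat.floor_eq_iff (by linarith)).2 ⟨by simpa using h1.le, by norm_num; exact h2⟩
  rw [rlOrder, this]

theorem rlOrder_add_two_eq_four {α : ℝ} (h1 : 1 < α) (h2 : α < 2) : rlOrder (α + 2) = 4 := by
  have : ⌊α + 2⌋₊ = 3 :=
    (Nat.floor_eq_iff (by linarith)).2 ⟨by norm_num; linarith, by norm_num; linarith⟩
  rw [rlOrder, this]

/-- Both orders use the same fractional integral, of order 4 - (α+2) = 2 - α; only the number of
derivatives differs. -/
theorem HasLeftRLDeriv.of_add_two {α : ℝ} (h1 : 1 < α) (h2 : α < 2) {f : ℝ → ℂ}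
    (h : HasLeftRLDeriv (α + 2) f) : HasLeftRLDeriv α f := by
  rw [HasLeftRLDeriv, rlOrder_add_two_eq_four h1 h2,
    show ((4 : ℕ) : ℝ) - (α + 2) = 2 - α by push_cast; ring] at h
  rw [HasLeftRLDeriv, rlOrder_eq_two h1 h2]
  push_cast
  exact ⟨h.1, fun k hk => h.2 k (by omega)⟩

/-- A function whose tempered derivative of order `α + 2` exists and is integrable together with
its Fourier transform is the inverse Fourier transform of a density `g` for which
`(λ - iω)^{α+2} g` is integrable, and the Riemann–Liouville derivative of order `α` acts as the
multiplier `(λ - iω)^α`. -/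
theorem exists_density {α lam : ℝ} (h1 : 1 < α) (h2 : α < 2) (hlam : 0 ≤ lam) {G : ℝ → ℂ}
    (hG : Integrable G) (hGhat : Integrable (fourierHat G))
    (hex : HasLeftRLDeriv (α + 2) (expMul lam G))
    (hD : Integrable (temperedRLDeriv (α + 2) lam G))
    (hDhat : Integrable (fourierHat (temperedRLDeriv (α + 2) lam G))) :
    ∃ g : ℝ → ℂ, Integrable g ∧
      (∀ᵐ x : ℝ, G x = ∫ w : ℝ, Complex.exp (-(Complex.I * w * x)) * g w) ∧
      Integrable (fun w => freq lam w ^ (α : ℂ) * g w) ∧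
      Integrable (fun w => ‖freq lam w‖ ^ (α + 2) * ‖g w‖) ∧
      ∀ x, leftRLDeriv α (expMul lam G) x = expInt lam (fun w => freq lam w ^ (α : ℂ) * g w) x := by
  set g : ℝ → ℂ := fun w => ((1 / (2 * Real.pi) : ℝ) : ℂ) * fourierHat G w with hgdef
  have hg : Integrable g := hGhat.const_mul _
  have hGg : ∀ᵐ x : ℝ, G x = ∫ w : ℝ, Complex.exp (-(Complex.I * w * x)) * g w := by
    filter_upwards [ae_eq_integral_fourierHat hG hGhat] with x hx
    rw [hx, ← integral_const_mul]
    refine integral_congr_ae (.of_forall fun w => ?_)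
    simp only [hgdef]
    ring
  have hB : ∀ w, ‖g w‖ ≤ 1 / (2 * Real.pi) * ∫ x, ‖G x‖ := fun w => by
    rw [hgdef, norm_mul, Complex.norm_real, Real.norm_of_nonneg (by positivity)]
    gcongr
    exact norm_fourierHat_le G w
  set s := 2 - α with hs
  have hs0 : 0 < s := by linarith
  have hs1 : s < 1 := by linarith
  have hexp : ∀ᵐ x : ℝ, expMul lam G x = expInt lam g x := by
    filter_upwards [hGg] with x hx
    rw [expMul, hx, expInt_eq]
  have hex' := hex
  rw [HasLeftRLDeriv, rlOrder_add_two_eq_four h1 h2,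
    show ((4 : ℕ) : ℝ) - (α + 2) = s by rw [hs]; push_cast; ring] at hex'
  obtain ⟨hint, hdiff⟩ := hex'
  set φ : ℝ → ℂ := fun w => freq lam w ^ (-(s : ℂ)) * g w with hφdef
  have hφ : Integrable φ := by
    simpa using integrable_freq_cpow_neg_mul hs0 hs1 lam 0 hg hB
  -- This holds at every x: altering G on a null set does not affect the integral.
  have hI : leftRLIntegral s (expMul lam G) = expInt lam φ := funext fun x =>
    leftRLIntegral_eq_expInt hs0 hs1 hlam hg hB hexp (hint x)
  rw [hI] at hdiff
  have hder : ∀ k < 4, ∀ x, HasDerivAt (iteratedDeriv k (expInt lam φ))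
      (iteratedDeriv (k + 1) (expInt lam φ) x) x := fun k hk x => by
    rw [iteratedDeriv_succ]
    exact (hdiff k hk x).hasDerivAt
  have hL4 : ∀ x, leftRLDeriv (α + 2) (expMul lam G) x = iteratedDeriv 4 (expInt lam φ) x := by
    intro x
    rw [leftRLDeriv, rlOrder_add_two_eq_four h1 h2,
      show ((4 : ℕ) : ℝ) - (α + 2) = s by rw [hs]; push_cast; ring, hI]
  -- Adding back λ^{α+2}G leaves v(x) = e^{-λx}D^{α+2}[e^{λ·}G](x), to which inversion applies.
  set v : ℝ → ℂ := fun x => temperedRLDeriv (α + 2) lam G x + ((lam ^ (α + 2) : ℝ) : ℂ) * G x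
    with hv
  have hvint : Integrable v := hD.add (hG.const_mul _)
  have hvhat : Integrable (fourierHat v) := by
    rw [show fourierHat v = _ from funext (fourierHat_add_const_mul hD hG _)]
    exact hDhat.add (hGhat.const_mul _)
  set q : ℝ → ℂ := fun w => ((1 / (2 * Real.pi) : ℝ) : ℂ) * fourierHat v w with hq
  have hqint : Integrable q := hvhat.const_mul _
  have hF4 : iteratedDeriv 4 (expInt lam φ) =ᵐ[volume] expInt lam q := by
    filter_upwards [ae_eq_integral_fourierHat hvint hvhat] with x hx
    have hvx : v x = Real.exp (-(lam * x)) * iteratedDeriv 4 (expInt lam φ) x := by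
      rw [hv, ← hL4]
      simp only [temperedRLDeriv]
      ring
    have hE : (Real.exp (lam * x) : ℂ) * Real.exp (-(lam * x)) = 1 := by
      rw [← Complex.ofReal_mul, ← Real.exp_add, add_neg_cancel, Real.exp_zero, Complex.ofReal_one]
    have : iteratedDeriv 4 (expInt lam φ) x = Real.exp (lam * x) * v x := by
      rw [hvx, ← mul_assoc, hE, one_mul]
    rw [this, expInt_eq, hx, ← integral_const_mul]
    congr 1
    refine integral_congr_ae (.of_forall fun w => ?_)
    simp only [hq]
    ring
  have h0 : ∀ x, HasDerivAt (expInt lam φ) (iteratedDeriv 1 (expInt lam φ) x) x := by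
    simpa using hder 0 (by norm_num)
  have hqφ := ae_eq_freq_pow_four_mul hlam hφ hqint h0 (hder 1 (by norm_num))
    (hder 2 (by norm_num)) (hder 3 (by norm_num)) hF4
  have hφ4 : Integrable fun w => freq lam w ^ 4 * φ w := hqint.congr hqφ
  -- Intermediate powers lie between the powers 0 and 4, according to whether ‖z‖ ≤ 1 or ‖z‖ ≥ 1.
  have hbd : ∀ k ≤ 4, ∀ w, ‖freq lam w ^ k * φ w‖ ≤ ‖φ w‖ + ‖freq lam w ^ 4 * φ w‖ := by
    intro k hk w
    rw [norm_mul (freq lam w ^ k) (φ w), norm_mul (freq lam w ^ 4) (φ w), norm_pow, norm_pow]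
    rcases le_total ‖freq lam w‖ 1 with h | h
    · have := mul_le_of_le_one_left (norm_nonneg (φ w))
        (pow_le_one₀ (n := k) (norm_nonneg (freq lam w)) h)
      have : 0 ≤ ‖freq lam w‖ ^ 4 * ‖φ w‖ := by positivity
      linarith
    · have := mul_le_mul_of_nonneg_right (pow_le_pow_right₀ h hk) (norm_nonneg (φ w))
      linarith [norm_nonneg (φ w)]
  have hφk : ∀ k ≤ 4, Integrable fun w => freq lam w ^ k * φ w := fun k hk =>
    (hφ.norm.add hφ4.norm).mono'
      (((continuous_freq lam).pow k).aestronglyMeasurable.mul hφ.aestronglyMeasurable)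
      (.of_forall (hbd k hk))
  have hφ1 : Integrable fun w => freq lam w * φ w := by simpa using hφk 1 (by norm_num)
  have hφ2 : Integrable fun w => freq lam w * (freq lam w * φ w) :=
    (hφk 2 (by norm_num)).congr (.of_forall fun w => by simp only; ring)
  have hpow : ∀ k : ℕ, ∀ᵐ w : ℝ, freq lam w ^ k * φ w = freq lam w ^ ((k - s : ℝ) : ℂ) * g w := by
    intro k
    filter_upwards [ae_ne_zero_real] with w hw
    rw [hφdef, ← mul_assoc, ← Complex.cpow_natCast, ← Complex.cpow_add _ _ (freq_ne_zero hw)]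
    push_cast
    rfl
  have hp2 : ∀ᵐ w : ℝ, freq lam w * (freq lam w * φ w) = freq lam w ^ (α : ℂ) * g w := by
    filter_upwards [hpow 2] with w hw
    rw [← mul_assoc, ← sq, hw, hs]
    push_cast
    ring_nf
  refine ⟨g, hg, hGg, hφ2.congr hp2, ?_, fun x => ?_⟩
  · refine hφ4.norm.congr ?_
    filter_upwards [hpow 4] with w hw
    rw [hw, norm_mul, Complex.norm_cpow_real, hs]
    congr 2
    push_cast
    ring
  · rw [leftRLDeriv, rlOrder_eq_two h1 h2, show ((2 : ℕ) : ℝ) - α = s by rw [hs]; push_cast; rfl, hI]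
    have d1 : deriv (expInt lam φ) = expInt lam fun w => freq lam w * φ w :=
      funext fun x => (hasDerivAt_expInt hφ hφ1 x).deriv
    rw [iteratedDeriv_succ, iteratedDeriv_one, d1, (hasDerivAt_expInt hφ1 hφ2 x).deriv]
    refine integral_congr_ae (hp2.mono fun w hw => ?_)
    simp only
    rw [hw]

/-! ### Scaling, the Grünwald multiplier and the pointwise estimate -/

theorem exists_scaled_symbol_bound {α : ℝ} (hα : 0 < α) (r₁ r₂ r₃ : ℝ) (h₁ : r₁ = α / 2 + r₃)
    (h₂ : r₂ = (2 - α) / 2 - 2 * r₃) {lam : ℝ} (hlam : 0 ≤ lam) (h₀ : ℝ) :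
    ∃ C, 0 ≤ C ∧ ∀ h : ℝ, 0 < h → h ≤ h₀ → ∀ z : ℂ, z.re = lam →
      ‖z ^ (α : ℂ) - ((1 / h ^ α : ℝ) : ℂ) * ((r₁ * Complex.exp (h * z) + r₂
        + r₃ * Complex.exp (-(h * z))) * (1 - Complex.exp (-(h * z))) ^ (α : ℂ))‖
        ≤ C * h ^ 2 * ‖z‖ ^ (α + 2) := by
  -- For h ≤ h₀ the point hz has real part hλ ≤ λh₀, so one strip serves all step sizes.
  obtain ⟨C, hC, hb⟩ := exists_symbol_bound hα r₁ r₂ r₃ h₁ h₂ (lam * h₀)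
  refine ⟨C, hC, fun h hh hh₀ z hz => ?_⟩
  have hpos : 0 < h ^ α := Real.rpow_pos_of_pos hh _
  have hne : ((h ^ α : ℝ) : ℂ) ≠ 0 := by exact_mod_cast hpos.ne'
  have hre : ((h : ℂ) * z).re = h * lam := by rw [Complex.re_ofReal_mul, hz]
  have key := hb (h * z) (by rw [hre]; positivity) (by rw [hre, mul_comm]; gcongr)
  have hscale : ((h : ℂ) * z) ^ (α : ℂ) = ((h ^ α : ℝ) : ℂ) * z ^ (α : ℂ) := by
    rcases eq_or_ne z 0 with rfl | hz0
    · have : (α : ℂ) ≠ 0 := by exact_mod_cast hα.ne'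
      simp [Complex.zero_cpow this]
    · rw [Complex.cpow_def_of_ne_zero (mul_ne_zero (by exact_mod_cast hh.ne') hz0),
        Complex.cpow_def_of_ne_zero hz0, Complex.log_ofReal_mul hh hz0, add_mul, Complex.exp_add,
        Real.rpow_def_of_pos hh]
      push_cast
      rfl
  have e : z ^ (α : ℂ) - ((1 / h ^ α : ℝ) : ℂ) * ((r₁ * Complex.exp (h * z) + r₂
        + r₃ * Complex.exp (-(h * z))) * (1 - Complex.exp (-(h * z))) ^ (α : ℂ))
      = ((1 / h ^ α : ℝ) : ℂ) * (((h : ℂ) * z) ^ (α : ℂ) - (r₁ * Complex.exp (h * z) + r₂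
        + r₃ * Complex.exp (-(h * z))) * (1 - Complex.exp (-(h * z))) ^ (α : ℂ)) := by
    rw [hscale]
    push_cast at hne ⊢
    field_simp
  rw [e, norm_mul, Complex.norm_real, Real.norm_of_nonneg (by positivity), one_div_mul_eq_div,
    div_le_iff₀ hpos]
  refine key.trans_eq ?_
  rw [norm_mul, Complex.norm_real, Real.norm_of_nonneg hh.le,
    Real.mul_rpow hh.le (norm_nonneg _), Real.rpow_add hh, Real.rpow_two]
  ring

theorem integrable_exp_mul_of_bounded {g m : ℝ → ℂ} (hg : Integrable g) (hm : Measurable m) {B : ℝ}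
    (hB : ∀ w, ‖m w‖ ≤ B) (x : ℝ) :
    Integrable fun w : ℝ => Complex.exp (-(Complex.I * w * x)) * (m w * g w) := by
  refine (hg.bdd_mul hm.aestronglyMeasurable (.of_forall hB)).bdd_mul (c := 1)
    (by fun_prop : Continuous _).aestronglyMeasurable (.of_forall fun w => ?_)
  simp [Complex.norm_exp]

theorem norm_exp_mul_freq (p h lam w : ℝ) :
    ‖Complex.exp (p * (h * freq lam w))‖ = Real.exp (p * (h * lam)) := by
  rw [Complex.norm_exp]
  simp

/-- The symbol `e^{phz} (1 - e^{-hz})^α` of the shifted Grünwald sum, at `z = λ - iω`. -/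
noncomputable def grunwaldSymbol (α lam h p w : ℝ) : ℂ :=
  Complex.exp (p * (h * freq lam w)) * (1 - Complex.exp (-(h * freq lam w))) ^ (α : ℂ)

theorem measurable_grunwaldSymbol (α lam h p : ℝ) : Measurable (grunwaldSymbol α lam h p) := by
  have := (continuous_freq lam).measurable
  unfold grunwaldSymbol
  fun_prop

theorem norm_grunwaldSymbol_le {α lam h : ℝ} (hα : 0 ≤ α) (hlam : 0 ≤ lam) (hh : 0 ≤ h)
    (p w : ℝ) : ‖grunwaldSymbol α lam h p w‖ ≤ Real.exp (p * (h * lam)) * 2 ^ α := by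
  rw [grunwaldSymbol, norm_mul, norm_exp_mul_freq]
  gcongr
  exact norm_one_sub_exp_neg_cpow_le hα (by simp; positivity)

/-- The shifted Grünwald series of an inverse Fourier transform acts on the density as a
multiplier. -/
theorem hasSum_grunwaldTerm {α lam h : ℝ} (h1 : 1 ≤ α) (h2 : α ≤ 2) (hlam : 0 ≤ lam) (hh : 0 ≤ h)
    {g : ℝ → ℂ} (hg : Integrable g) (p x : ℝ) :
    HasSum (grunwaldTerm α lam h p
        (fun x => ∫ w : ℝ, Complex.exp (-(Complex.I * w * x)) * g w) x)
      (∫ w : ℝ, Complex.exp (-(Complex.I * w * x)) * (grunwaldSymbol α lam h p w * g w)) := by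
  set T : ℕ → ℝ → ℂ := fun j w => Complex.exp (-(Complex.I * w * x)) *
    (((grunwaldWeight α j : ℂ) * Complex.exp (p * (h * freq lam w)) *
      Complex.exp (-(h * freq lam w)) ^ j) * g w) with hT
  have hone : ∀ w, ‖Complex.exp (-(h * freq lam w))‖ ≤ 1 := fun w => by
    rw [Complex.norm_exp, Real.exp_le_one_iff]
    simp
    positivity
  have hmb : ∀ j w, ‖(grunwaldWeight α j : ℂ) * Complex.exp (p * (h * freq lam w)) *
      Complex.exp (-(h * freq lam w)) ^ j‖ ≤ ‖grunwaldWeight α j‖ * Real.exp (p * (h * lam)) := by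
    intro j w
    rw [norm_mul, norm_mul, norm_exp_mul_freq, norm_pow, Complex.norm_real]
    exact mul_le_of_le_one_right (by positivity) (pow_le_one₀ (norm_nonneg _) (hone w))
  have hTint : ∀ j, Integrable (T j) := fun j =>
    integrable_exp_mul_of_bounded hg (by fun_prop : Continuous _).measurable (hmb j) x
  have hTn : ∀ j w, ‖T j w‖ ≤ ‖grunwaldWeight α j‖ * Real.exp (p * (h * lam)) * ‖g w‖ := by
    intro j w
    rw [hT, norm_mul, norm_mul _ (g w), show ‖Complex.exp (-(Complex.I * w * x))‖ = 1 by
      simp [Complex.norm_exp], one_mul]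
    gcongr
    exact hmb j w
  have hsum : Summable fun j => ∫ w, ‖T j w‖ := by
    refine Summable.of_nonneg_of_le (fun j => integral_nonneg fun w => norm_nonneg _) (fun j => ?_)
      ((summable_grunwaldWeight h1 h2).norm.mul_right (Real.exp (p * (h * lam)) * ∫ w, ‖g w‖))
    rw [← mul_assoc, ← integral_const_mul]
    exact integral_mono (hTint j).norm (hg.norm.const_mul _) (hTn j)
  have hS := hasSum_integral_of_summable_integral_norm hTint hsum
  have e1 : ∀ j, ∫ w, T j w = grunwaldTerm α lam h p
      (fun x => ∫ w : ℝ, Complex.exp (-(Complex.I * w * x)) * g w) x j := by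
    intro j
    rw [grunwaldTerm, ← integral_const_mul]
    refine integral_congr_ae (.of_forall fun w => ?_)
    have hexp : Complex.exp (-(Complex.I * w * x)) * Complex.exp (p * (h * freq lam w)) *
        Complex.exp (-(h * freq lam w)) ^ j = Complex.exp ((-((j : ℝ) - p) * lam * h : ℝ) : ℂ) *
        Complex.exp (-(Complex.I * w * ((x - ((j : ℝ) - p) * h : ℝ) : ℂ))) := by
      rw [← Complex.exp_nat_mul, ← Complex.exp_add, ← Complex.exp_add, ← Complex.exp_add, freq]
      congr 1
      push_cast
      ring
    simp only [hT]
    rw [Complex.ofReal_mul, Complex.ofReal_exp]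
    linear_combination (grunwaldWeight α j : ℂ) * g w * hexp
  have e2 : ∫ w, ∑' j, T j w
      = ∫ w : ℝ, Complex.exp (-(Complex.I * w * x)) * (grunwaldSymbol α lam h p w * g w) := by
    refine integral_congr_ae (.of_forall fun w => ?_)
    simp only [hT, grunwaldSymbol]
    rw [← tsum_grunwaldWeight h1 h2 (hone w), tsum_mul_left, tsum_mul_right, ← tsum_mul_left]
    congr 3
    funext j
    ring
  rw [e2] at hS
  exact (funext e1 : _ = grunwaldTerm α lam h p _ x) ▸ hS

theorem grunwaldTerm_congr {α lam h p x : ℝ} {G F : ℝ → ℂ}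
    (hGF : ∀ j : ℕ, G (x - ((j : ℝ) - p) * h) = F (x - ((j : ℝ) - p) * h)) :
    grunwaldTerm α lam h p G x = grunwaldTerm α lam h p F x := by
  funext j
  rw [grunwaldTerm, grunwaldTerm, hGF]

/-- The series at x samples only countably many translates, so the exceptional null sets can be
united. -/
theorem ae_forall_shift_eq {G F : ℝ → ℂ} (hGF : G =ᵐ[volume] F) (h p : ℝ) :
    ∀ᵐ x : ℝ, ∀ j : ℕ, G (x - ((j : ℝ) - p) * h) = F (x - ((j : ℝ) - p) * h) :=
  ae_all_iff.2 fun j =>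
    (measurePreserving_sub_right volume (((j : ℝ) - p) * h)).quasiMeasurePreserving.ae hGF

/-- Second-order consistency at a point, for functions agreeing along the grid with an inverse
Fourier transform. -/
theorem norm_temperedRLDeriv_sub_weightedGrunwald_le {α lam h C : ℝ} (h1 : 1 < α) (h2 : α < 2)
    (hlam : 0 ≤ lam) (hh : 0 < h) (hC : 0 ≤ C) {r₁ r₂ r₃ : ℝ} {G g : ℝ → ℂ} (hg : Integrable g)
    (hgα : Integrable fun w => freq lam w ^ (α : ℂ) * g w)
    (hgα2 : Integrable fun w => ‖freq lam w‖ ^ (α + 2) * ‖g w‖)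
    (hC' : ∀ z : ℂ, z.re = lam →
      ‖z ^ (α : ℂ) - ((1 / h ^ α : ℝ) : ℂ) * ((r₁ * Complex.exp (h * z) + r₂
        + r₃ * Complex.exp (-(h * z))) * (1 - Complex.exp (-(h * z))) ^ (α : ℂ))‖
        ≤ C * h ^ 2 * ‖z‖ ^ (α + 2)) {x : ℝ}
    (hD : leftRLDeriv α (expMul lam G) x = expInt lam (fun w => freq lam w ^ (α : ℂ) * g w) x)
    (hGF : ∀ p ∈ ({1, 0, -1} : Set ℝ), ∀ j : ℕ, G (x - ((j : ℝ) - p) * h)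
      = ∫ w : ℝ, Complex.exp (-(Complex.I * w * ((x - ((j : ℝ) - p) * h : ℝ) : ℂ))) * g w) :
    ‖temperedRLDeriv α lam G x - weightedGrunwald α lam h r₁ r₂ r₃ G x‖
      ≤ C * ((∫ w, ‖freq lam w‖ ^ (α + 2) * ‖g w‖) + lam ^ (α + 2) * ∫ w, ‖g w‖) * h ^ 2 := by
  set F : ℝ → ℂ := fun x => ∫ w : ℝ, Complex.exp (-(Complex.I * w * x)) * g w with hF
  have hx : G x = F x := by simpa using hGF 0 (by simp) 0
  set E : ℝ → ℂ := fun w => Complex.exp (-(Complex.I * w * x)) with hE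
  have hA : ∀ p ∈ ({1, 0, -1} : Set ℝ), shiftedGrunwald α lam h p G x = ((1 / h ^ α : ℝ) : ℂ) *
      (∫ w, E w * (grunwaldSymbol α lam h p w * g w))
      - ((Real.exp (p * h * lam) * ((1 - Real.exp (-(h * lam))) ^ α / h ^ α) : ℝ) : ℂ) * F x := by
    intro p hp
    rw [shiftedGrunwald, grunwaldTerm_congr (F := F) (hGF p hp),
      (hasSum_grunwaldTerm h1.le h2.le hlam hh.le hg p x).tsum_eq, hx]
  set c : ℂ := ((1 / h ^ α : ℝ) : ℂ) with hc
  set S : ℂ → ℂ := fun z => z ^ (α : ℂ) - c * ((r₁ * Complex.exp (h * z) + r₂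
        + r₃ * Complex.exp (-(h * z))) * (1 - Complex.exp (-(h * z))) ^ (α : ℂ)) with hS
  have hEn : ∀ w, ‖E w‖ = 1 := fun w => by simp [hE, Complex.norm_exp]
  have iα : Integrable fun w => E w * (freq lam w ^ (α : ℂ) * g w) :=
    hgα.bdd_mul (c := 1) (by fun_prop : Continuous E).aestronglyMeasurable
      (.of_forall fun w => (hEn w).le)
  have ip : ∀ p : ℝ, Integrable fun w => E w * (grunwaldSymbol α lam h p w * g w) := fun p =>
    integrable_exp_mul_of_bounded hg (measurable_grunwaldSymbol α lam h p)
      (norm_grunwaldSymbol_le (by linarith) hlam hh.le p) x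
  have hT : temperedRLDeriv α lam G x
      = (∫ w, E w * (freq lam w ^ (α : ℂ) * g w)) - ((lam ^ α : ℝ) : ℂ) * F x := by
    rw [temperedRLDeriv, hD, expInt_eq, hx, ← mul_assoc, ← Complex.ofReal_mul, ← Real.exp_add,
      neg_add_cancel, Real.exp_zero, Complex.ofReal_one, one_mul]
  -- The terms subtracted from the derivative and from the three shifted operators combine into the
  -- same error symbol at z = λ, so they obey the same bound.
  have hScal : S lam = ((lam ^ α : ℝ) : ℂ)
      - (r₁ * ((Real.exp (1 * h * lam) * ((1 - Real.exp (-(h * lam))) ^ α / h ^ α) : ℝ) : ℂ)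
      + r₂ * ((Real.exp (0 * h * lam) * ((1 - Real.exp (-(h * lam))) ^ α / h ^ α) : ℝ) : ℂ)
      + r₃ * ((Real.exp (-1 * h * lam) * ((1 - Real.exp (-(h * lam))) ^ α / h ^ α) : ℝ) : ℂ)) := by
    have hnn : 0 ≤ 1 - Real.exp (-(h * lam)) := by
      rw [sub_nonneg, Real.exp_le_one_iff]
      have := mul_nonneg hh.le hlam
      linarith
    rw [hS, hc, Complex.ofReal_cpow hlam]
    push_cast [Complex.ofReal_cpow hnn]
    simp only [one_mul, zero_mul, Complex.exp_zero, neg_mul]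
    ring
  have hint : ∫ w, E w * (S (freq lam w) * g w) = (∫ w, E w * (freq lam w ^ (α : ℂ) * g w))
      - (r₁ * (c * ∫ w, E w * (grunwaldSymbol α lam h 1 w * g w))
      + r₂ * (c * ∫ w, E w * (grunwaldSymbol α lam h 0 w * g w))
      + r₃ * (c * ∫ w, E w * (grunwaldSymbol α lam h (-1) w * g w))) := by
    simp only [← integral_const_mul]
    have i1 := ((ip 1).const_mul c).const_mul (r₁ : ℂ)
    have i2 := ((ip 0).const_mul c).const_mul (r₂ : ℂ)
    have i3 := ((ip (-1)).const_mul c).const_mul (r₃ : ℂ)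
    have e12 := integral_add i1 i2
    have e123 := integral_add (i1.add i2) i3
    have e := integral_sub iα ((i1.add i2).add i3)
    simp only [Pi.add_apply] at e e123
    rw [← e12, ← e123, ← e]
    refine integral_congr_ae (.of_forall fun w => ?_)
    simp only [hS, grunwaldSymbol]
    push_cast
    simp only [one_mul, zero_mul, Complex.exp_zero, neg_mul]
    ring
  have hdecomp : temperedRLDeriv α lam G x - weightedGrunwald α lam h r₁ r₂ r₃ G x
      = (∫ w, E w * (S (freq lam w) * g w)) - S lam * F x := by
    rw [weightedGrunwald, hA 1 (by simp), hA 0 (by simp), hA (-1) (by simp), hT, hint, hScal]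
    ring
  have b1 : ‖∫ w, E w * (S (freq lam w) * g w)‖
      ≤ C * h ^ 2 * ∫ w, ‖freq lam w‖ ^ (α + 2) * ‖g w‖ := by
    rw [← integral_const_mul]
    refine norm_integral_le_of_norm_le (hgα2.const_mul _) (.of_forall fun w => ?_)
    rw [norm_mul, hEn, one_mul, norm_mul, ← mul_assoc]
    gcongr
    exact hC' _ (freq_re lam w)
  have b2 : ‖S lam * F x‖ ≤ C * h ^ 2 * lam ^ (α + 2) * ∫ w, ‖g w‖ := by
    rw [norm_mul]
    have := hC' lam (by simp)
    rw [Complex.norm_real, Real.norm_of_nonneg hlam] at this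
    gcongr
    exact norm_integral_exp_mul_le g x
  rw [hdecomp]
  refine (norm_sub_le _ _).trans ((add_le_add b1 b2).trans_eq ?_)
  ring

end TemperedGrunwald

/-! ### Assembly of the result -/

theorem lemma2p4 (α lam r₁ r₂ r₃ : ℝ) (hα : 1 < α ∧ α < 2) (hlam : 0 ≤ lam)
    (hr₁ : r₁ = α / 2 + r₃) (hr₂ : r₂ = (2 - α) / 2 - 2 * r₃)
    (G : ℝ → ℂ) (hG : Integrable G volume)
    (hGhat : Integrable (TemperedGrunwald.fourierHat G) volume)
    (hex : TemperedGrunwald.HasLeftRLDeriv (α + 2) (TemperedGrunwald.expMul lam G))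
    (hD : Integrable (TemperedGrunwald.temperedRLDeriv (α + 2) lam G) volume)
    (hDhat : Integrable
      (TemperedGrunwald.fourierHat (TemperedGrunwald.temperedRLDeriv (α + 2) lam G)) volume) :
    r₁ + r₂ + r₃ = 1 ∧
    TemperedGrunwald.HasLeftRLDeriv α (TemperedGrunwald.expMul lam G) ∧
    (∀ h : ℝ, 0 < h → ∀ p : ℝ,
      (∀ᵐ x : ℝ ∂volume, Summable (TemperedGrunwald.grunwaldTerm α lam h p G x)) ∧
      (Continuous G → ∀ x : ℝ, Summable (TemperedGrunwald.grunwaldTerm α lam h p G x))) ∧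
    (∀ h₀ : ℝ, 0 < h₀ → ∃ C : ℝ, ∀ h : ℝ, 0 < h → h ≤ h₀ →
      (∀ᵐ x : ℝ ∂volume,
        ‖TemperedGrunwald.temperedRLDeriv α lam G x
          - TemperedGrunwald.weightedGrunwald α lam h r₁ r₂ r₃ G x‖ ≤ C * h ^ 2) ∧
      (Continuous G → ∀ x : ℝ,
        ‖TemperedGrunwald.temperedRLDeriv α lam G x
          - TemperedGrunwald.weightedGrunwald α lam h r₁ r₂ r₃ G x‖ ≤ C * h ^ 2)) := by
  obtain ⟨h1, h2⟩ := hα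
  obtain ⟨g, hg, hGg, hgα, hgα2, hDg⟩ :=
    TemperedGrunwald.exists_density h1 h2 hlam hG hGhat hex hD hDhat
  -- Continuous functions that agree almost everywhere on the line agree everywhere.
  have hcont : Continuous G → ∀ x : ℝ, G x = ∫ w : ℝ, Complex.exp (-(Complex.I * w * x)) * g w :=
    fun hc => congrFun ((Continuous.ae_eq_iff_eq volume hc
      (TemperedGrunwald.continuous_integral_exp_mul hg)).1 hGg)
  have hsum : ∀ h : ℝ, 0 < h → ∀ p x : ℝ, (∀ j : ℕ, G (x - ((j : ℝ) - p) * h)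
      = ∫ w : ℝ, Complex.exp (-(Complex.I * w * ((x - ((j : ℝ) - p) * h : ℝ) : ℂ))) * g w) →
      Summable (TemperedGrunwald.grunwaldTerm α lam h p G x) := fun h hh p x hx => by
    rw [TemperedGrunwald.grunwaldTerm_congr
      (F := fun x => ∫ w : ℝ, Complex.exp (-(Complex.I * w * x)) * g w) hx]
    exact (TemperedGrunwald.hasSum_grunwaldTerm h1.le h2.le hlam hh.le hg p x).summable
  refine ⟨by rw [hr₁, hr₂]; ring, hex.of_add_two h1 h2, fun h hh p => ⟨?_, fun hc x => ?_⟩,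
    fun h₀ _ => ?_⟩
  · exact (TemperedGrunwald.ae_forall_shift_eq hGg h p).mono fun x hx => hsum h hh p x hx
  · exact hsum h hh p x fun j => hcont hc _
  obtain ⟨C, hC, hb⟩ :=
    TemperedGrunwald.exists_scaled_symbol_bound (by linarith : 0 < α) r₁ r₂ r₃ hr₁ hr₂ hlam h₀
  refine ⟨C * ((∫ w, ‖TemperedGrunwald.freq lam w‖ ^ (α + 2) * ‖g w‖)
    + lam ^ (α + 2) * ∫ w, ‖g w‖), fun h hh hh₀ => ⟨?_, fun hc x => ?_⟩⟩
  · filter_upwards [TemperedGrunwald.ae_forall_shift_eq hGg h 1,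
      TemperedGrunwald.ae_forall_shift_eq hGg h 0,
      TemperedGrunwald.ae_forall_shift_eq hGg h (-1)] with x e1 e2 e3
    refine TemperedGrunwald.norm_temperedRLDeriv_sub_weightedGrunwald_le h1 h2 hlam hh hC hg hgα
      hgα2 (hb h hh hh₀) (hDg x) ?_
    rintro p (rfl | rfl | rfl)
    exacts [e1, e2, e3]
  · exact TemperedGrunwald.norm_temperedRLDeriv_sub_weightedGrunwald_le h1 h2 hlam hh hC hg hgα
      hgα2 (hb h hh hh₀) (hDg x) fun p _ j => hcont hc _
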